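/- Let $p\in[0,1]$ be fixed. For $n\ge 1$ consider a one-way street with parking spots $1,\dots,n$ and $n$ cars entering one after another, with preference vector $\alpha=(a_1,\dots,a_n)$ chosen uniformly at random from $\{1,\dots,n\}^n$. Car $i$ goes to spot $a_i$ and parks there if it is free. If it is occupied, the driver tosses a coin (independent of everything else) which shows heads with probability $p$: on heads the car drives forward (towards spot $n$) and takes the first free spot beyond $a_i$; on tails it drives backward (towards spot $1$) and takes the first free spot it meets. In either case, if there is no free spot in the chosen direction, the car leaves the street without parking. Write $\alpha\in\mathrm{PF}_n$ for the event that all $n$ cars park. Then, as $n\to\infty$, $$\mathbb{E}\big(a_n \mid \alpha\in\mathrm{PF}_n\big)=\frac{n+1}{2}-(2p-1)\left[\frac{\sqrt{2\pi}}{4}\,n^{1/2}-\frac{7}{6}\right]+o(1).$$ -/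

import Mathlib

open MeasureTheory ProbabilityTheory Asymptotics Filter

namespace ParkingCoin

/-- Spots `1, …, n` of the one-way street are represented by `Fin n`, spot `k` being the element
with value `k - 1`; `Fin n` also indexes the cars, in order of arrival.

`parkSpot S a heads` is the spot taken by a car that prefers spot `a` when the set of occupied
spots is `S`. If `a` is free the car parks there. Otherwise it drives to the end of the street
(`heads = true`) or back to its start (`heads = false`) and takes the first free spot
it meets; `none` means that there is no such spot and the car leaves the street. -/
def parkSpot {n : ℕ} (S : Finset (Fin n)) (a : Fin n) (heads : Bool) : Option (Fin n) :=
  if a ∉ S then some a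
  else if heads = true then
    if h : (Finset.univ.filter fun k : Fin n => a < k ∧ k ∉ S).Nonempty then
      some ((Finset.univ.filter fun k : Fin n => a < k ∧ k ∉ S).min' h)
    else none
  else
    if h : (Finset.univ.filter fun k : Fin n => k < a ∧ k ∉ S).Nonempty then
      some ((Finset.univ.filter fun k : Fin n => k < a ∧ k ∉ S).max' h)
    else none

/-- The set of occupied spots after the first `i` cars have entered the street, for the preference
vector `a` and the coin tosses `c` (the toss `c j` is used only if car `j` finds its preferred
spot occupied). -/
def occupied {n : ℕ} (a : Fin n → Fin n) (c : Fin n → Bool) : ℕ → Finset (Fin n)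
  | 0 => ∅
  | i + 1 =>
    if h : i < n then
      match parkSpot (occupied a c i) (a ⟨i, h⟩) (c ⟨i, h⟩) with
      | some k => insert k (occupied a c i)
      | none => occupied a c i
    else occupied a c i

/-- All `n` cars with preferences `a` and coin tosses `c` find a spot. -/
def AllPark {n : ℕ} (a : Fin n → Fin n) (c : Fin n → Bool) : Prop :=
  ∀ i : Fin n, (parkSpot (occupied a c i) (a i) (c i)).isSome = true

/-- A sample point: the preference vector and one coin toss for every car. -/
abbrev Sample (n : ℕ) : Type := (Fin n → Fin n) × (Fin n → Bool)

/-- The event that `α` is a parking function, i.e. that all cars park. -/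
def parkEvent (n : ℕ) : Set (Sample n) := {ω | AllPark ω.1 ω.2}

/-- The preference vector is uniform on `[n]^n`; independently of it, the coins are independent and
show heads with probability `p`. -/
noncomputable def parkMeasure (n : ℕ) (p : unitInterval) : Measure (Sample n) :=
  (uniformOn (Set.univ : Set (Fin n → Fin n))).prod
    (Measure.pi fun _ : Fin n => bernoulliMeasure true false p)

/-- The preference of the last car, as a number in `{1, …, n}` (and `0` if there are no cars). -/
def lastPreference : (n : ℕ) → (Fin n → Fin n) → ℕ
  | 0, _ => 0
  | m + 1, a => (a (Fin.last m) : ℕ) + 1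

/-- The conditional expectation of the last preference, given that all cars park. -/
noncomputable def condMeanLast (n : ℕ) (p : unitInterval) : ℝ :=
  ∫ ω, (lastPreference n ω.1 : ℝ) ∂((parkMeasure n p)[|parkEvent n])

end ParkingCoin

/-! Let the first m = n - 1 cars leave exactly spot k free (spots numbered from 0). A spot that is
still free has never been preferred or crossed, so the cars on its two sides do not interact: they
form two smaller parking functions, shuffled in `m.choose k` ways (`wordSum_spots_eq_erase`). The
last car takes spot k exactly when it prefers k, or a spot below k with heads, or a spot above k
with tails. Summing over k (`sum_last_car`) yields a recursion for the total weight of parking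
functions. Abel's identity and the symmetry between k and m - k show that this weight is (n + 1) ^
(n - 1), whatever p is (`parkWeight_eq`).

The same decomposition, with the last preference inserted, gives the exact mean (n + 1) / 2 - (2p -
1) (Q - 1) / 2, where Q is the sum over j of `m.choose j` * j! / (m + 2) ^ j (`condMeanLast_succ`).

For the asymptotics, put N = m + 2. Then Q is the integral of exp(-x) (1 + x / N) ^ m over x > 0.
With s = 1 / √N and x = t / s it becomes 1 / s times the integral of `kern s t`, which is exp(-t² /
2) (1 + s (t³ / 3 - 2t) + o(s)). By dominated convergence Q = √(2πN) / 2 - 4/3 + o(1), and half of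
-4/3 - 1 is the constant -7/6. -/

namespace ParkingCoin

/-! ### Parking on the infinite street -/

/-- On the two-sided infinite street `ℤ` with occupied spots `S`, a car with preference `a` and
coin `h` takes spot `t`. -/
def IsNextSpot (S : Finset ℤ) (a : ℤ) (h : Bool) (t : ℤ) : Prop :=
  t ∉ S ∧ ((h = true ∧ a ≤ t ∧ ∀ s, a ≤ s → s < t → s ∈ S) ∨
    (h = false ∧ t ≤ a ∧ ∀ s, t < s → s ≤ a → s ∈ S))

/-- A finite set contains no half-line, so parking on `ℤ` never fails. Leaving the finite street
will correspond to landing outside its interval. -/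
lemma exists_isNextSpot (S : Finset ℤ) (a : ℤ) (h : Bool) : ∃ t, IsNextSpot S a h t := by
  classical
  cases h
  · have hex : ∃ d : ℕ, a - d ∉ S := by
      by_contra! H
      exact Set.infinite_of_injective_forall_mem (f := fun d : ℕ => a - (d : ℤ))
        (fun x y hxy => by simpa using hxy) (fun d => H d) S.finite_toSet
    refine ⟨a - Nat.find hex, Nat.find_spec hex, Or.inr ⟨rfl, by omega, fun s h1 h2 => ?_⟩⟩
    have := Nat.find_min hex (m := (a - s).toNat) (by omega)
    rw [not_not] at this
    convert this using 1
    omega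
  · have hex : ∃ d : ℕ, a + d ∉ S := by
      by_contra! H
      exact Set.infinite_of_injective_forall_mem (f := fun d : ℕ => a + (d : ℤ))
        (fun x y hxy => by simpa using hxy) (fun d => H d) S.finite_toSet
    refine ⟨a + Nat.find hex, Nat.find_spec hex, Or.inl ⟨rfl, by omega, fun s h1 h2 => ?_⟩⟩
    have := Nat.find_min hex (m := (s - a).toNat) (by omega)
    rw [not_not] at this
    convert this using 1
    omega

lemma IsNextSpot.unique {S : Finset ℤ} {a : ℤ} {h : Bool} {t t' : ℤ}
    (ht : IsNextSpot S a h t) (ht' : IsNextSpot S a h t') : t = t' := by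
  obtain ⟨h1, h2⟩ := ht
  obtain ⟨h1', h2'⟩ := ht'
  rcases lt_trichotomy t t' with hlt | heq | hgt
  · grind
  · exact heq
  · grind

noncomputable def nextSpot (S : Finset ℤ) (a : ℤ) (h : Bool) : ℤ := (exists_isNextSpot S a h).choose

lemma isNextSpot_nextSpot (S : Finset ℤ) (a : ℤ) (h : Bool) : IsNextSpot S a h (nextSpot S a h) :=
  (exists_isNextSpot S a h).choose_spec

lemma nextSpot_notMem (S : Finset ℤ) (a : ℤ) (h : Bool) : nextSpot S a h ∉ S :=
  (isNextSpot_nextSpot S a h).1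

lemma nextSpot_eq_iff {S : Finset ℤ} {a : ℤ} {h : Bool} {t : ℤ} :
    nextSpot S a h = t ↔ IsNextSpot S a h t :=
  ⟨fun e => e ▸ isNextSpot_nextSpot S a h, fun ht => (isNextSpot_nextSpot S a h).unique ht⟩

lemma nextSpot_of_notMem {S : Finset ℤ} {a : ℤ} (h : Bool) (ha : a ∉ S) : nextSpot S a h = a := by
  rw [nextSpot_eq_iff]
  refine ⟨ha, ?_⟩
  cases h
  · exact Or.inr ⟨rfl, le_rfl, by omega⟩
  · exact Or.inl ⟨rfl, le_rfl, by omega⟩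

/-- A car starting to the left of the free spot `k` stops at `k` at the latest, so it never sees the
cars of `B`. -/
lemma nextSpot_union_of_lt {A B : Finset ℤ} {a k : ℤ} (h : Bool) (hA : ∀ s ∈ A, s < k)
    (hB : ∀ s ∈ B, k < s) (ha : a < k) :
    nextSpot (A ∪ B) a h = nextSpot A a h ∧ nextSpot A a h ≤ k := by
  have key := isNextSpot_nextSpot (A ∪ B) a h
  set t := nextSpot (A ∪ B) a h
  obtain ⟨h1, h2⟩ := key
  have htk : t ≤ k := by
    rcases h2 with ⟨_, h3, h4⟩ | ⟨_, h3, _⟩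
    · by_contra hlt
      rcases Finset.mem_union.1 (h4 k (by omega) (by omega)) with h5 | h5
      · exact absurd (hA _ h5) (lt_irrefl _)
      · exact absurd (hB _ h5) (lt_irrefl _)
    · omega
  have : IsNextSpot A a h t := by
    refine ⟨fun h5 => h1 (Finset.mem_union_left _ h5), ?_⟩
    rcases h2 with ⟨e, h3, h4⟩ | ⟨e, h3, h4⟩
    · refine Or.inl ⟨e, h3, fun s hs hs' => ?_⟩
      rcases Finset.mem_union.1 (h4 s hs hs') with h5 | h5
      · exact h5
      · have := hB _ h5
        omega
    · refine Or.inr ⟨e, h3, fun s hs hs' => ?_⟩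
      rcases Finset.mem_union.1 (h4 s hs hs') with h5 | h5
      · exact h5
      · have := hB _ h5
        omega
  rw [nextSpot_eq_iff.2 this]
  exact ⟨rfl, htk⟩

lemma nextSpot_union_of_gt {A B : Finset ℤ} {a k : ℤ} (h : Bool) (hA : ∀ s ∈ A, s < k)
    (hB : ∀ s ∈ B, k < s) (ha : k < a) :
    nextSpot (A ∪ B) a h = nextSpot B a h ∧ k ≤ nextSpot B a h := by
  have key := isNextSpot_nextSpot (A ∪ B) a h
  set t := nextSpot (A ∪ B) a h
  obtain ⟨h1, h2⟩ := key
  have htk : k ≤ t := by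
    rcases h2 with ⟨_, h3, _⟩ | ⟨_, h3, h4⟩
    · omega
    · by_contra hlt
      rcases Finset.mem_union.1 (h4 k (by omega) (by omega)) with h5 | h5
      · exact absurd (hA _ h5) (lt_irrefl _)
      · exact absurd (hB _ h5) (lt_irrefl _)
  have : IsNextSpot B a h t := by
    refine ⟨fun h5 => h1 (Finset.mem_union_right _ h5), ?_⟩
    rcases h2 with ⟨e, h3, h4⟩ | ⟨e, h3, h4⟩
    · refine Or.inl ⟨e, h3, fun s hs hs' => ?_⟩
      rcases Finset.mem_union.1 (h4 s hs hs') with h5 | h5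
      · have := hA _ h5
        omega
      · exact h5
    · refine Or.inr ⟨e, h3, fun s hs hs' => ?_⟩
      rcases Finset.mem_union.1 (h4 s hs hs') with h5 | h5
      · have := hA _ h5
        omega
      · exact h5
  rw [nextSpot_eq_iff.2 this]
  exact ⟨rfl, htk⟩

/-- The occupied spots of the infinite street after the cars of `w` have parked; the head of `w` is
the most recent car. -/
noncomputable def spots : List (ℤ × Bool) → Finset ℤ
  | [] => ∅
  | x :: w => insert (nextSpot (spots w) x.1 x.2) (spots w)

@[simp] lemma spots_nil : spots [] = ∅ := rfl

lemma spots_cons (x : ℤ × Bool) (w : List (ℤ × Bool)) :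
    spots (x :: w) = insert (nextSpot (spots w) x.1 x.2) (spots w) := rfl

lemma card_spots (w : List (ℤ × Bool)) : (spots w).card = w.length := by
  induction w with
  | nil => rfl
  | cons x w ih => rw [spots_cons, Finset.card_insert_of_notMem (nextSpot_notMem _ _ _), ih]; rfl

def below (k : ℤ) (w : List (ℤ × Bool)) : List (ℤ × Bool) := w.filter fun x => x.1 < k
def above (k : ℤ) (w : List (ℤ × Bool)) : List (ℤ × Bool) := w.filter fun x => k < x.1

/-- Spots are never vacated, so `k` was free throughout. No car can have preferred it, and each car
stayed on its own side, by `nextSpot_union_of_lt` and `nextSpot_union_of_gt`. -/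
lemma spots_of_notMem {k : ℤ} {w : List (ℤ × Bool)} (hk : k ∉ spots w) :
    (∀ x ∈ w, x.1 ≠ k) ∧ (∀ s ∈ spots (below k w), s < k) ∧ (∀ s ∈ spots (above k w), k < s) ∧
      spots w = spots (below k w) ∪ spots (above k w) := by
  induction w with
  | nil => simp [below, above]
  | cons x w ih =>
    rw [spots_cons, Finset.mem_insert, not_or] at hk
    obtain ⟨hne, hk⟩ := hk
    obtain ⟨h1, h2, h3, h4⟩ := ih hk
    rcases lt_trichotomy x.1 k with hx | hx | hx
    · have eb : below k (x :: w) = x :: below k w := by simp [below, hx]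
      have ea : above k (x :: w) = above k w := by simp [above, hx.le]
      obtain ⟨e, hle⟩ := nextSpot_union_of_lt x.2 h2 h3 hx
      rw [h4, e] at hne
      rw [eb, ea, spots_cons, spots_cons, h4, e]
      refine ⟨?_, ?_, h3, by rw [Finset.insert_union]⟩
      · intro y hy
        rcases List.mem_cons.1 hy with rfl | hy
        · exact hx.ne
        · exact h1 y hy
      · intro s hs
        rcases Finset.mem_insert.1 hs with rfl | hs
        · omega
        · exact h2 s hs
    · exact absurd (by rw [hx, nextSpot_of_notMem _ hk]) hne
    · have eb : below k (x :: w) = below k w := by simp [below, hx.le]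
      have ea : above k (x :: w) = x :: above k w := by simp [above, hx]
      obtain ⟨e, hle⟩ := nextSpot_union_of_gt x.2 h2 h3 hx
      rw [h4, e] at hne
      rw [eb, ea, spots_cons, spots_cons, h4, e]
      refine ⟨?_, h2, ?_, by rw [Finset.union_insert]⟩
      · intro y hy
        rcases List.mem_cons.1 hy with rfl | hy
        · exact hx.ne'
        · exact h1 y hy
      · intro s hs
        rcases Finset.mem_insert.1 hs with rfl | hs
        · omega
        · exact h3 s hs

lemma notMem_spots {k : ℤ} {w : List (ℤ × Bool)} (hw : ∀ x ∈ w, x.1 ≠ k)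
    (hb : k ∉ spots (below k w)) (ha : k ∉ spots (above k w)) : k ∉ spots w := by
  induction w with
  | nil => simp
  | cons x w ih =>
    have hx := hw x List.mem_cons_self
    have hw' : ∀ y ∈ w, y.1 ≠ k := fun y hy => hw y (List.mem_cons_of_mem _ hy)
    rcases lt_or_gt_of_ne hx with hx | hx
    · have eb : below k (x :: w) = x :: below k w := by simp [below, hx]
      have ea : above k (x :: w) = above k w := by simp [above, hx.le]
      rw [eb, spots_cons, Finset.mem_insert, not_or] at hb
      rw [ea] at ha
      have hk := ih hw' hb.2 ha
      obtain ⟨-, h2, h3, h4⟩ := spots_of_notMem hk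
      rw [spots_cons, Finset.mem_insert, not_or, h4, (nextSpot_union_of_lt x.2 h2 h3 hx).1, ← h4]
      exact ⟨hb.1, hk⟩
    · have eb : below k (x :: w) = below k w := by simp [below, hx.le]
      have ea : above k (x :: w) = x :: above k w := by simp [above, hx]
      rw [ea, spots_cons, Finset.mem_insert, not_or] at ha
      rw [eb] at hb
      have hk := ih hw' hb ha.2
      obtain ⟨-, h2, h3, h4⟩ := spots_of_notMem hk
      rw [spots_cons, Finset.mem_insert, not_or, h4, (nextSpot_union_of_gt x.2 h2 h3 hx).1, ← h4]
      exact ⟨ha.1, hk⟩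

lemma spots_eq_erase_iff {l k r : ℤ} (hl : l ≤ k) (hr : k < r) (w : List (ℤ × Bool)) :
    spots w = (Finset.Ico l r).erase k ↔ (∀ x ∈ w, x.1 ≠ k) ∧
      spots (below k w) = Finset.Ico l k ∧ spots (above k w) = Finset.Ico (k + 1) r := by
  constructor
  · intro h
    obtain ⟨h1, h2, h3, h4⟩ := spots_of_notMem (k := k) (w := w) (by simp [h])
    rw [h4] at h
    refine ⟨h1, ?_, ?_⟩
    · ext s
      have := congrArg (s ∈ ·) h
      have := h2 s
      have := h3 s
      grind
    · ext s
      have := congrArg (s ∈ ·) h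
      have := h2 s
      have := h3 s
      grind
  · rintro ⟨h1, h2, h3⟩
    have := notMem_spots h1 (by simp [h2]) (by simp [h3])
    rw [(spots_of_notMem this).2.2.2, h2, h3]
    ext s
    grind

lemma nextSpot_map_add (S : Finset ℤ) (a c : ℤ) (h : Bool) :
    nextSpot (S.map (addRightEmbedding c)) (a + c) h = nextSpot S a h + c := by
  obtain ⟨h1, h2⟩ := isNextSpot_nextSpot S a h
  have mem : ∀ s, s ∈ S.map (addRightEmbedding c) ↔ s - c ∈ S := fun s => by
    simp only [Finset.mem_map, addRightEmbedding_apply]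
    exact ⟨by rintro ⟨t, ht, rfl⟩; simpa using ht, fun hs => ⟨_, hs, by ring⟩⟩
  rw [nextSpot_eq_iff]
  refine ⟨by simpa [mem] using h1, ?_⟩
  rcases h2 with ⟨e, h3, h4⟩ | ⟨e, h3, h4⟩
  · exact Or.inl ⟨e, by omega, fun s hs hs' => (mem s).2 (h4 _ (by omega) (by omega))⟩
  · exact Or.inr ⟨e, by omega, fun s hs hs' => (mem s).2 (h4 _ (by omega) (by omega))⟩

lemma spots_map_add (c : ℤ) (w : List (ℤ × Bool)) :
    spots (w.map fun x => (x.1 + c, x.2)) = (spots w).map (addRightEmbedding c) := by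
  induction w with
  | nil => rfl
  | cons x w ih =>
    rw [List.map_cons, spots_cons, spots_cons, ih, nextSpot_map_add, Finset.map_insert]
    rfl

/-- The last car fills the interval precisely when one hole is left and it either prefers that hole
or drives towards it. -/
lemma insert_nextSpot_eq_Ico_iff {l r a : ℤ} {S : Finset ℤ} (h : Bool) (ha : a ∈ Finset.Ico l r) :
    insert (nextSpot S a h) S = Finset.Ico l r ↔
      ∃ k ∈ Finset.Ico l r, S = (Finset.Ico l r).erase k ∧
        (a = k ∨ (a < k ∧ h = true) ∨ (k < a ∧ h = false)) := by
  have hn := isNextSpot_nextSpot S a h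
  constructor
  · intro e
    refine ⟨nextSpot S a h, e ▸ Finset.mem_insert_self _ _, ?_, ?_⟩
    · rw [← e, Finset.erase_insert hn.1]
    · obtain ⟨h1, ⟨h2, h3, h4⟩ | ⟨h2, h3, h4⟩⟩ := hn <;> grind
  · rintro ⟨k, hk, rfl, hc⟩
    have : nextSpot ((Finset.Ico l r).erase k) a h = k := by
      rw [nextSpot_eq_iff]
      refine ⟨by simp, ?_⟩
      cases h
      · exact Or.inr ⟨rfl, by grind, by grind⟩
      · exact Or.inl ⟨rfl, by grind, by grind⟩
    rw [this, Finset.insert_erase hk]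

/-! ### Weighted sums over words -/

section WordSum

variable {α β : Type*}

/-- The sum of `f` over all words of length `n` in the alphabet `X`, each word being weighted by
the product of the weights of its letters. -/
def wordSum (μ : α → ℝ) (X : Finset α) : ℕ → (List α → ℝ) → ℝ
  | 0, f => f []
  | n + 1, f => ∑ x ∈ X, μ x * wordSum μ X n fun w => f (x :: w)

lemma wordSum_zero (μ : α → ℝ) (X : Finset α) (f : List α → ℝ) : wordSum μ X 0 f = f [] := rfl

lemma wordSum_succ (μ : α → ℝ) (X : Finset α) (n : ℕ) (f : List α → ℝ) :
    wordSum μ X (n + 1) f = ∑ x ∈ X, μ x * wordSum μ X n fun w => f (x :: w) := rfl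

lemma wordSum_congr {μ : α → ℝ} {X : Finset α} {n : ℕ} {f g : List α → ℝ}
    (h : ∀ w : List α, w.length = n → (∀ x ∈ w, x ∈ X) → f w = g w) :
    wordSum μ X n f = wordSum μ X n g := by
  induction n generalizing f g with
  | zero => exact h [] rfl (by simp)
  | succ n ih =>
    rw [wordSum_succ, wordSum_succ]
    refine Finset.sum_congr rfl fun x hx => ?_
    rw [ih fun w hw hw' => h (x :: w) (by simp [hw]) (by simpa [hx] using hw')]

lemma wordSum_const_zero (μ : α → ℝ) (X : Finset α) (n : ℕ) :
    wordSum μ X n (fun _ => 0) = 0 := by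
  induction n with
  | zero => rfl
  | succ n ih => simp [wordSum_succ, ih]

lemma wordSum_const_mul (μ : α → ℝ) (X : Finset α) (n : ℕ) (c : ℝ) (f : List α → ℝ) :
    wordSum μ X n (fun w => c * f w) = c * wordSum μ X n f := by
  induction n generalizing f with
  | zero => rfl
  | succ n ih =>
    simp only [wordSum_succ, ih, Finset.mul_sum]
    exact Finset.sum_congr rfl fun x _ => by ring

lemma wordSum_finset_sum {ι : Type*} (μ : α → ℝ) (X : Finset α) (n : ℕ) (I : Finset ι)
    (f : ι → List α → ℝ) :
    wordSum μ X n (fun w => ∑ i ∈ I, f i w) = ∑ i ∈ I, wordSum μ X n (f i) := by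
  induction n generalizing f with
  | zero => rfl
  | succ n ih =>
    simp only [wordSum_succ, ih fun i w => f i (_ :: w), Finset.mul_sum]
    exact Finset.sum_comm

lemma wordSum_filter (μ : α → ℝ) (X : Finset α) (P : α → Prop) [DecidablePred P] (n : ℕ)
    (f : List α → ℝ) :
    wordSum μ X n (fun w => if ∀ x ∈ w, P x then f w else 0) = wordSum μ (X.filter P) n f := by
  induction n generalizing f with
  | zero => simp [wordSum_zero]
  | succ n ih =>
    rw [wordSum_succ, wordSum_succ, Finset.sum_filter]
    refine Finset.sum_congr rfl fun x _ => ?_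
    by_cases hx : P x
    · simp [hx, ← ih]
    · simp [hx, wordSum_const_zero]

lemma wordSum_map (μ : α → ℝ) (ν : β → ℝ) (e : α ↪ β) (h : ∀ x, ν (e x) = μ x) (X : Finset α)
    (n : ℕ) (f : List β → ℝ) :
    wordSum ν (X.map e) n f = wordSum μ X n fun w => f (w.map e) := by
  induction n generalizing f with
  | zero => rfl
  | succ n ih => simp [wordSum_succ, ih, h]

/-- A word is determined by its two subwords and the positions of the letters satisfying `P`. In the
induction, the first letter joins one of the subwords, which is Pascal's rule. -/
lemma wordSum_shuffle (μ : α → ℝ) (X : Finset α) (P : α → Prop) [DecidablePred P] (n : ℕ)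
    (f g : List α → ℝ) :
    wordSum μ X n (fun w => f (w.filter fun x => P x) * g (w.filter fun x => ¬ P x)) =
      ∑ ij ∈ Finset.HasAntidiagonal.antidiagonal n, (n.choose ij.1 : ℝ) *
        (wordSum μ (X.filter P) ij.1 f * wordSum μ (X.filter fun x => ¬ P x) ij.2 g) := by
  induction n generalizing f g with
  | zero => simp [wordSum_zero]
  | succ n ih =>
    rw [Finset.sum_antidiagonal_choose_succ_mul
      (fun i j => wordSum μ (X.filter P) i f * wordSum μ (X.filter fun x => ¬ P x) j g) n,
      wordSum_succ, ← Finset.sum_filter_add_sum_filter_not X P, add_comm]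
    congr 1
    · simp only [wordSum_succ, Finset.mul_sum]
      rw [Finset.sum_comm]
      refine Finset.sum_congr rfl fun x hx => ?_
      have hx' : ¬ P x := (Finset.mem_filter.1 hx).2
      simp only [List.filter_cons, hx', not_false_eq_true, decide_true, decide_false, if_true,
        Bool.false_eq_true, if_false]
      rw [ih f fun w => g (x :: w), Finset.mul_sum]
      exact Finset.sum_congr rfl fun ij _ => by ring
    · simp only [wordSum_succ, Finset.mul_sum, Finset.sum_mul]
      rw [Finset.sum_comm]
      refine Finset.sum_congr rfl fun x hx => ?_
      have hx' : P x := (Finset.mem_filter.1 hx).2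
      simp only [List.filter_cons, hx', not_true_eq_false, decide_true, decide_false, if_true,
        Bool.false_eq_true, if_false]
      rw [ih (fun w => f (x :: w)) g, Finset.mul_sum]
      refine Finset.sum_congr rfl fun ij hij => ?_
      rw [Nat.choose_symm_of_eq_add (Finset.HasAntidiagonal.mem_antidiagonal.1 hij).symm]
      ring

/-- The reversal makes the last car the head of the word, so that `wordSum_succ` splits off the last
car. -/
lemma sum_ofFn_reverse [Fintype α] (μ : α → ℝ) (n : ℕ) (f : List α → ℝ) :
    ∑ g : Fin n → α, (∏ i, μ (g i)) * f (List.ofFn g).reverse = wordSum μ Finset.univ n f := by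
  induction n generalizing f with
  | zero => simp [wordSum_zero]
  | succ n ih =>
    rw [wordSum_succ, ← (Fin.snocEquiv fun _ => α).sum_comp, Fintype.sum_prod_type]
    refine Finset.sum_congr rfl fun x _ => ?_
    rw [← ih, Finset.mul_sum]
    refine Finset.sum_congr rfl fun g _ => ?_
    simp only [Fin.snocEquiv_apply, Fin.prod_univ_castSucc, List.ofFn_succ', Fin.snoc_castSucc,
      Fin.snoc_last, List.concat_eq_append, List.reverse_append, List.reverse_singleton,
      List.singleton_append]
    ring

end WordSum

/-! ### Parking weights and the hole left for the last car -/

noncomputable def street (l r : ℤ) : Finset (ℤ × Bool) := Finset.Ico l r ×ˢ Finset.univ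

def coinWeight (p : ℝ) (x : ℤ × Bool) : ℝ := if x.2 = true then p else 1 - p

/-- The total weight of the words of length `m` with which the cars fill the spots `[l, r)`. -/
noncomputable def parkSum (p : ℝ) (l r : ℤ) (m : ℕ) : ℝ :=
  wordSum (coinWeight p) (street l r) m fun w => if spots w = Finset.Ico l r then 1 else 0

/-- The total weight of the parking functions of length `n`. -/
noncomputable def parkWeight (p : ℝ) (n : ℕ) : ℝ := parkSum p 0 n n

lemma parkSum_eq_zero {p : ℝ} {l r : ℤ} {m : ℕ} (h : (r - l).toNat ≠ m) : parkSum p l r m = 0 := by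
  refine (wordSum_congr fun w hw _ => if_neg fun e => h ?_).trans
    (wordSum_const_zero (coinWeight p) (street l r) m)
  rw [← hw, ← card_spots, e, Int.card_Ico]

lemma parkSum_add (p : ℝ) (l r c : ℤ) (m : ℕ) :
    parkSum p (l + c) (r + c) m = parkSum p l r m := by
  let e : ℤ × Bool ↪ ℤ × Bool :=
    ⟨fun x => (x.1 + c, x.2), fun x y h => by
      simp only [Prod.mk.injEq, add_left_inj] at h
      exact Prod.ext h.1 h.2⟩
  have he : ∀ x, e x = (x.1 + c, x.2) := fun _ => rfl
  have hs : street (l + c) (r + c) = (street l r).map e := by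
    ext ⟨a, h⟩
    simp only [street, Finset.mem_product, Finset.mem_Ico, Finset.mem_univ, and_true,
      Finset.mem_map, Prod.exists, he, Prod.mk.injEq]
    exact ⟨fun ha => ⟨a - c, h, by omega, by ring, rfl⟩, by rintro ⟨b, _, hb, rfl, rfl⟩; omega⟩
  rw [parkSum, hs, wordSum_map (coinWeight p) (coinWeight p) e (fun _ => rfl), parkSum]
  congr 1
  funext w
  have hi : Finset.Ico (l + c) (r + c) = (Finset.Ico l r).map (addRightEmbedding c) := by
    rw [Finset.map_add_right_Ico]
  have := spots_map_add c w
  change (if spots (w.map fun x => (x.1 + c, x.2)) = _ then (1 : ℝ) else 0) = _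
  rw [this, hi]
  simp only [Finset.map_inj]

lemma wordSum_spots_eq_erase (p : ℝ) {m k : ℕ} (hk : k ≤ m) :
    wordSum (coinWeight p) (street 0 (m + 1)) m
      (fun w => if spots w = (Finset.Ico 0 ((m : ℤ) + 1)).erase k then 1 else 0) =
      m.choose k * (parkWeight p k * parkWeight p (m - k)) := by
  set f : List (ℤ × Bool) → ℝ := fun w => if spots w = Finset.Ico 0 (k : ℤ) then 1 else 0
  set g : List (ℤ × Bool) → ℝ :=
    fun w => if spots w = Finset.Ico ((k : ℤ) + 1) (m + 1) then 1 else 0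
  have h1 : wordSum (coinWeight p) (street 0 (m + 1)) m
      (fun w => if spots w = (Finset.Ico 0 ((m : ℤ) + 1)).erase k then 1 else 0) =
      wordSum (coinWeight p) (street 0 (m + 1)) m (fun w => if ∀ x ∈ w, x.1 ≠ (k : ℤ) then
        f (w.filter fun x => x.1 < (k : ℤ)) * g (w.filter fun x => ¬ x.1 < (k : ℤ)) else 0) := by
    refine wordSum_congr fun w _ _ => ?_
    by_cases hw : ∀ x ∈ w, x.1 ≠ (k : ℤ)
    · have ha : above k w = w.filter fun x => ¬ x.1 < (k : ℤ) :=
        List.filter_congr fun x hx => by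
          have := hw x hx
          exact decide_eq_decide.2 (by omega)
      rw [if_pos hw, ← ha]
      simp only [spots_eq_erase_iff (l := 0) (k := k) (r := m + 1) (by omega) (by omega), f, g]
      change _ = (if spots (below k w) = _ then (1 : ℝ) else 0) * _
      grind
    · rw [if_neg hw, if_neg]
      exact fun e => hw ((spots_eq_erase_iff (by omega) (by omega) w).1 e).1
  rw [h1, wordSum_filter _ _ (fun x : ℤ × Bool => x.1 ≠ (k : ℤ)),
    wordSum_shuffle _ _ (fun x : ℤ × Bool => x.1 < (k : ℤ))]
  have hlo : ((street 0 (m + 1)).filter fun x => x.1 ≠ (k : ℤ)).filter (fun x => x.1 < (k : ℤ)) =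
      street 0 k := by
    ext x
    simp only [street, Finset.mem_filter, Finset.mem_product, Finset.mem_Ico, Finset.mem_univ,
      and_true, ne_eq]
    omega
  have hhi : ((street 0 (m + 1)).filter fun x => x.1 ≠ (k : ℤ)).filter (fun x => ¬ x.1 < (k : ℤ)) =
      street (k + 1) (m + 1) := by
    ext x
    simp only [street, Finset.mem_filter, Finset.mem_product, Finset.mem_Ico, Finset.mem_univ,
      and_true, ne_eq]
    omega
  -- Each car fills one spot, so exactly `k` of the cars must lie to the left of the hole.
  rw [hlo, hhi, Finset.sum_eq_single (k, m - k)]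
  · have h2 := parkSum_add p 0 ((m - k : ℕ) : ℤ) (k + 1) (m - k)
    rw [show (0 : ℤ) + (k + 1) = k + 1 by ring,
      show ((m - k : ℕ) : ℤ) + (k + 1) = m + 1 by omega] at h2
    rw [parkWeight, parkWeight, ← h2]
    rfl
  · rintro ⟨i, j⟩ hij hne
    have hi : i ≠ k := by
      rintro rfl
      rw [Finset.HasAntidiagonal.mem_antidiagonal] at hij
      exact hne (by ext <;> simp; omega)
    have : wordSum (coinWeight p) (street 0 k) i f = 0 := parkSum_eq_zero (by omega)
    simp [this]
  · intro h
    exact absurd (by rw [Finset.HasAntidiagonal.mem_antidiagonal]; dsimp only; omega) h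

lemma sum_Ico_int (n : ℕ) (φ : ℤ → ℝ) :
    ∑ a ∈ Finset.Ico (0 : ℤ) n, φ a = ∑ a ∈ Finset.range n, φ a := by
  refine (Finset.sum_nbij (fun a : ℕ => (a : ℤ)) ?_ ?_ ?_ fun _ _ => rfl).symm
  · intro a ha
    simpa using ha
  · exact fun a _ b _ h => by simpa using h
  · intro a ha
    simp only [Finset.coe_Ico, Set.mem_Ico] at ha
    exact ⟨a.toNat, by simp; omega, by simp; omega⟩

/-- Decomposition of the last car's contribution according to the spot left free for it. -/
lemma sum_last_car (p : ℝ) (m : ℕ) (φ : ℤ → ℝ) :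
    ∑ x ∈ street 0 (m + 1), coinWeight p x * (φ x.1 *
      wordSum (coinWeight p) (street 0 (m + 1)) m
        (fun w => if spots (x :: w) = Finset.Ico 0 ((m : ℤ) + 1) then 1 else 0)) =
    ∑ k ∈ Finset.range (m + 1), m.choose k * (parkWeight p k * parkWeight p (m - k)) *
      ∑ a ∈ Finset.range (m + 1), (if a = k then 1 else if a < k then p else 1 - p) * φ a := by
  have key : ∀ x ∈ street 0 (m + 1), wordSum (coinWeight p) (street 0 (m + 1)) m
      (fun w => if spots (x :: w) = Finset.Ico 0 ((m : ℤ) + 1) then 1 else 0) =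
      ∑ k ∈ Finset.range (m + 1),
        (if x.1 = k ∨ (x.1 < k ∧ x.2 = true) ∨ (k < x.1 ∧ x.2 = false) then 1 else 0) *
          (m.choose k * (parkWeight p k * parkWeight p (m - k))) := by
    intro x hx
    have hx1 : x.1 ∈ Finset.Ico 0 ((m : ℤ) + 1) := (Finset.mem_product.1 hx).1
    -- The hole is determined by `w`, so at most one summand is nonzero.
    have : ∀ w : List (ℤ × Bool),
        (if spots (x :: w) = Finset.Ico 0 ((m : ℤ) + 1) then (1 : ℝ) else 0) =
        ∑ k ∈ Finset.range (m + 1),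
          (if x.1 = k ∨ (x.1 < k ∧ x.2 = true) ∨ (k < x.1 ∧ x.2 = false) then (1 : ℝ) else 0) *
            (if spots w = (Finset.Ico 0 ((m : ℤ) + 1)).erase k then 1 else 0) := by
      intro w
      rw [spots_cons]
      by_cases h : insert (nextSpot (spots w) x.1 x.2) (spots w) = Finset.Ico 0 ((m : ℤ) + 1)
      · rw [if_pos h]
        obtain ⟨k, hk, hs, hc⟩ := (insert_nextSpot_eq_Ico_iff x.2 hx1).1 h
        rw [Finset.mem_Ico] at hk
        lift k to ℕ using hk.1
        rw [Finset.sum_eq_single k, if_pos hc, if_pos hs, mul_one]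
        · intro j hj hjk
          rw [if_neg (c := spots w = _), mul_zero]
          rw [hs]
          intro e
          have hm : (j : ℤ) ∈ (Finset.Ico 0 ((m : ℤ) + 1)).erase k := by
            rw [Finset.mem_range] at hj
            rw [Finset.mem_erase, Finset.mem_Ico]
            omega
          rw [e] at hm
          exact Finset.notMem_erase _ _ hm
        · intro hk'
          rw [Finset.mem_range] at hk'
          omega
      · rw [if_neg h]
        symm
        refine Finset.sum_eq_zero fun k hk => ?_
        by_contra hne
        have h1 := left_ne_zero_of_mul hne
        have h2 := right_ne_zero_of_mul hne
        rw [Finset.mem_range] at hk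
        refine h ((insert_nextSpot_eq_Ico_iff x.2 hx1).2 ⟨k, ?_, ?_, ?_⟩)
        · rw [Finset.mem_Ico]
          omega
        · by_contra h3
          exact h2 (if_neg h3)
        · by_contra h3
          exact h1 (if_neg h3)
    simp only [this, wordSum_finset_sum, wordSum_const_mul]
    refine Finset.sum_congr rfl fun k hk => ?_
    rw [wordSum_spots_eq_erase p (Nat.lt_succ_iff.1 (Finset.mem_range.1 hk))]
  rw [Finset.sum_congr rfl fun x hx => by rw [key x hx]]
  simp only [Finset.mul_sum]
  rw [Finset.sum_comm]
  refine Finset.sum_congr rfl fun k _ => ?_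
  rw [street, Finset.sum_product, show ((m : ℤ) + 1) = ((m + 1 : ℕ) : ℤ) by push_cast; rfl,
    sum_Ico_int (m + 1)]
  refine Finset.sum_congr rfl fun a _ => ?_
  -- At `a = k` both coin outcomes are admissible, of total weight 1; elsewhere only one is.
  simp only [Fintype.sum_bool, coinWeight, Nat.cast_inj, Nat.cast_lt]
  rcases lt_trichotomy a k with h | h | h
  · simp only [h, h.ne, h.not_gt]
    simp
    ring
  · simp [h]
    ring
  · simp only [h, h.ne', h.not_gt]
    simp
    ring

/-! ### Comparison of the finite street with the infinite one -/

section FiniteStreet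

variable {n : ℕ}

def toIntSet (S : Finset (Fin n)) : Finset ℤ := S.image fun k : Fin n => ((k : ℕ) : ℤ)

lemma mem_toIntSet {S : Finset (Fin n)} {t : ℤ} : t ∈ toIntSet S ↔ ∃ k ∈ S, ((k : ℕ) : ℤ) = t := by
  simp [toIntSet]

lemma coe_mem_toIntSet {S : Finset (Fin n)} {k : Fin n} : ((k : ℕ) : ℤ) ∈ toIntSet S ↔ k ∈ S := by
  rw [mem_toIntSet]
  exact ⟨by rintro ⟨j, hj, e⟩; rwa [← Fin.ext (Nat.cast_injective e)], fun h => ⟨k, h, rfl⟩⟩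

lemma toIntSet_subset (S : Finset (Fin n)) : toIntSet S ⊆ Finset.Ico 0 (n : ℤ) := by
  intro t ht
  obtain ⟨k, -, rfl⟩ := mem_toIntSet.1 ht
  simp

lemma mem_toIntSet_of_forall {S : Finset (Fin n)} {s : ℤ} (h0 : 0 ≤ s) (hn : s < n)
    (h : ∀ k : Fin n, ((k : ℕ) : ℤ) = s → k ∈ S) : s ∈ toIntSet S := by
  lift s to ℕ using h0
  exact coe_mem_toIntSet.2 (h ⟨s, by omega⟩ rfl)

lemma nextSpot_of_parkSpot_eq_some {S : Finset (Fin n)} {a k : Fin n} {h : Bool}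
    (e : parkSpot S a h = some k) : nextSpot (toIntSet S) a h = k := by
  rw [parkSpot] at e
  by_cases h1 : a ∈ S
  · rw [if_neg (not_not.2 h1)] at e
    by_cases h2 : h = true
    · rw [if_pos h2] at e
      by_cases h3 : (Finset.univ.filter fun k : Fin n => a < k ∧ k ∉ S).Nonempty
      · rw [dif_pos h3, Option.some_inj] at e
        have hm := Finset.min'_mem _ h3
        have hl := fun j => Finset.min'_le (Finset.univ.filter fun k : Fin n => a < k ∧ k ∉ S) j
        rw [e] at hm
        simp only [e, Finset.mem_filter, Finset.mem_univ, true_and] at hm hl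
        refine nextSpot_eq_iff.2 ⟨by rw [coe_mem_toIntSet]; exact hm.2, Or.inl ⟨h2, ?_, ?_⟩⟩
        · have := hm.1
          rw [Fin.lt_def] at this
          omega
        · intro s hs hs'
          refine mem_toIntSet_of_forall (by omega) (by omega) ?_
          rintro j rfl
          by_contra hj
          have haj : a ≠ j := by rintro rfl; exact hj h1
          have := hl j ⟨lt_of_le_of_ne (by rw [Fin.le_def]; omega) haj, hj⟩
          rw [Fin.le_def] at this
          omega
      · rw [dif_neg h3] at e
        exact absurd e (by simp)
    · rw [if_neg h2] at e
      by_cases h3 : (Finset.univ.filter fun k : Fin n => k < a ∧ k ∉ S).Nonempty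
      · rw [dif_pos h3, Option.some_inj] at e
        have hm := Finset.max'_mem _ h3
        have hl := fun j => Finset.le_max' (Finset.univ.filter fun k : Fin n => k < a ∧ k ∉ S) j
        rw [e] at hm
        simp only [e, Finset.mem_filter, Finset.mem_univ, true_and] at hm hl
        refine nextSpot_eq_iff.2
          ⟨by rw [coe_mem_toIntSet]; exact hm.2, Or.inr ⟨by simpa using h2, ?_, ?_⟩⟩
        · have := hm.1
          rw [Fin.lt_def] at this
          omega
        · intro s hs hs'
          refine mem_toIntSet_of_forall (by omega) (by omega) ?_
          rintro j rfl
          by_contra hj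
          have haj : j ≠ a := by rintro rfl; exact hj h1
          have := hl j ⟨lt_of_le_of_ne (by rw [Fin.le_def]; omega) haj, hj⟩
          rw [Fin.le_def] at this
          omega
      · rw [dif_neg h3] at e
        exact absurd e (by simp)
  · rw [if_pos h1, Option.some_inj] at e
    rw [← e]
    exact nextSpot_of_notMem _ (by rwa [coe_mem_toIntSet])

lemma nextSpot_of_parkSpot_eq_none {S : Finset (Fin n)} {a : Fin n} {h : Bool}
    (e : parkSpot S a h = none) : nextSpot (toIntSet S) a h ∉ Finset.Ico 0 (n : ℤ) := by
  intro ht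
  obtain ⟨hfree, hnext⟩ := isNextSpot_nextSpot (toIntSet S) a h
  generalize nextSpot (toIntSet S) a h = t at *
  rw [Finset.mem_Ico] at ht
  lift t to ℕ using ht.1
  have hfree' : (⟨t, by omega⟩ : Fin n) ∉ S := fun hm => hfree (coe_mem_toIntSet.2 hm)
  rw [parkSpot] at e
  by_cases h1 : a ∈ S
  · have hne : t ≠ a := by
      rintro rfl
      exact hfree' h1
    rw [if_neg (not_not.2 h1)] at e
    rcases hnext with ⟨h2, h5, -⟩ | ⟨h2, h5, -⟩
    · rw [if_pos h2, dif_pos] at e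
      · exact absurd e (by simp)
      · refine ⟨⟨t, by omega⟩, ?_⟩
        simp only [Finset.mem_filter, Finset.mem_univ, true_and, Fin.lt_def]
        exact ⟨by omega, hfree'⟩
    · rw [if_neg (by simp [h2]), dif_pos] at e
      · exact absurd e (by simp)
      · refine ⟨⟨t, by omega⟩, ?_⟩
        simp only [Finset.mem_filter, Finset.mem_univ, true_and, Fin.lt_def]
        exact ⟨by omega, hfree'⟩
  · rw [if_pos h1] at e
    exact absurd e (by simp)

/-- The sequence of cars, most recent car first. -/
def carWord (a : Fin n → Fin n) (c : Fin n → Bool) : List (ℤ × Bool) :=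
  (List.ofFn fun i => (((a i : ℕ) : ℤ), c i)).reverse

/-- The first `i` cars, most recent car first. -/
def firstCars (a : Fin n → Fin n) (c : Fin n → Bool) (i : ℕ) : List (ℤ × Bool) :=
  ((List.ofFn fun i => (((a i : ℕ) : ℤ), c i)).take i).reverse

variable (a : Fin n → Fin n) (c : Fin n → Bool)

lemma firstCars_zero : firstCars a c 0 = [] := by simp [firstCars]

lemma firstCars_succ {i : ℕ} (hi : i < n) :
    firstCars a c (i + 1) = (((a ⟨i, hi⟩ : ℕ) : ℤ), c ⟨i, hi⟩) :: firstCars a c i := by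
  rw [firstCars, firstCars, List.take_succ_eq_append_getElem (by simpa using hi)]
  simp

lemma firstCars_self : firstCars a c n = carWord a c := by
  rw [firstCars, carWord, List.take_of_length_le (by simp)]

lemma spots_firstCars_mono {i j : ℕ} (hij : i ≤ j) (hj : j ≤ n) :
    spots (firstCars a c i) ⊆ spots (firstCars a c j) := by
  induction j, hij using Nat.le_induction with
  | base => exact subset_rfl
  | succ j hij ih =>
    rw [firstCars_succ a c (by omega), spots_cons]
    exact (ih (by omega)).trans (Finset.subset_insert _ _)

lemma occupied_succ {i : ℕ} (hi : i < n) {k : Fin n}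
    (hk : parkSpot (occupied a c i) (a ⟨i, hi⟩) (c ⟨i, hi⟩) = some k) :
    occupied a c (i + 1) = insert k (occupied a c i) := by
  rw [occupied, dif_pos hi, hk]

lemma spots_firstCars_succ {i : ℕ} (hi : i < n) {k : Fin n}
    (h : spots (firstCars a c i) = toIntSet (occupied a c i))
    (hk : parkSpot (occupied a c i) (a ⟨i, hi⟩) (c ⟨i, hi⟩) = some k) :
    spots (firstCars a c (i + 1)) = toIntSet (occupied a c (i + 1)) := by
  rw [firstCars_succ a c hi, spots_cons, h, occupied_succ a c hi hk,
    nextSpot_of_parkSpot_eq_some hk, toIntSet, toIntSet, Finset.image_insert]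

/-- If all cars park, both streets agree step by step, and `n` distinct spots inside an interval of
size `n` exhaust it. Conversely, a car failing on the finite street would occupy a spot outside the
interval on `ℤ`, and that spot would stay occupied to the end. -/
lemma allPark_iff : AllPark a c ↔ spots (carWord a c) = Finset.Ico 0 (n : ℤ) := by
  constructor
  · intro h
    have key : ∀ i ≤ n, spots (firstCars a c i) = toIntSet (occupied a c i) := by
      intro i hi
      induction i with
      | zero => simp [firstCars_zero, occupied, toIntSet]
      | succ i ih =>
        obtain ⟨k, hk⟩ := Option.isSome_iff_exists.1 (h ⟨i, hi⟩)
        exact spots_firstCars_succ a c hi (ih (by omega)) hk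
    refine Finset.eq_of_subset_of_card_le ?_ ?_
    · rw [← firstCars_self, key n le_rfl]
      exact toIntSet_subset _
    · rw [card_spots]
      simp [carWord]
  · intro h
    have hsub : ∀ i ≤ n, spots (firstCars a c i) ⊆ Finset.Ico 0 (n : ℤ) := fun i hi => by
      rw [← h, ← firstCars_self]
      exact spots_firstCars_mono a c hi le_rfl
    have hpark : ∀ i (hi : i < n), spots (firstCars a c i) = toIntSet (occupied a c i) →
        (parkSpot (occupied a c i) (a ⟨i, hi⟩) (c ⟨i, hi⟩)).isSome = true := by
      intro i hi e
      by_contra hnone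
      rw [Bool.not_eq_true, Option.isSome_eq_false_iff, Option.isNone_iff_eq_none] at hnone
      refine nextSpot_of_parkSpot_eq_none hnone (hsub (i + 1) hi ?_)
      rw [firstCars_succ a c hi, spots_cons, e]
      exact Finset.mem_insert_self _ _
    have key : ∀ i ≤ n, spots (firstCars a c i) = toIntSet (occupied a c i) := by
      intro i hi
      induction i with
      | zero => simp [firstCars_zero, occupied, toIntSet]
      | succ i ih =>
        obtain ⟨k, hk⟩ := Option.isSome_iff_exists.1 (hpark i hi (ih (by omega)))
        exact spots_firstCars_succ a c hi (ih (by omega)) hk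
    exact fun i => hpark i i.2 (key i i.2.le)

end FiniteStreet

/-! ### The conditional mean as a quotient of weighted sums -/

lemma measureReal_parkMeasure_singleton (n : ℕ) (p : unitInterval) (ω : Sample n) :
    (parkMeasure n p).real {ω} =
      ((n : ℝ) ^ n)⁻¹ * ∏ i, (if ω.2 i = true then (p : ℝ) else 1 - p) := by
  classical
  obtain ⟨a, c⟩ := ω
  have h1 : (uniformOn (Set.univ : Set (Fin n → Fin n))) {a} = ((n : ENNReal) ^ n)⁻¹ := by
    rw [uniformOn_univ]
    simp
  rw [measureReal_def, parkMeasure, ← Set.singleton_prod_singleton, Measure.prod_prod, h1,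
    Measure.pi_singleton, ENNReal.toReal_mul, ENNReal.toReal_prod]
  congr 1
  · simp
  · refine Finset.prod_congr rfl fun i _ => ?_
    rw [← measureReal_def, bernoulliMeasure_real_apply _ (measurableSet_singleton _)]
    cases h : c i <;> simp [h]

instance (n : ℕ) (p : unitInterval) : IsFiniteMeasure (parkMeasure n p) := by
  unfold parkMeasure
  infer_instance

lemma setIntegral_parkMeasure (n : ℕ) (p : unitInterval) (f : Sample n → ℝ) :
    ∫ ω in parkEvent n, f ω ∂(parkMeasure n p) = ((n : ℝ) ^ n)⁻¹ *
      ∑ g : Fin n → Fin n × Bool, (∏ i, (if (g i).2 = true then (p : ℝ) else 1 - p)) *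
        (f (fun i => (g i).1, fun i => (g i).2) *
          if spots (carWord (fun i => (g i).1) fun i => (g i).2) = Finset.Ico 0 (n : ℤ)
            then 1 else 0) := by
  classical
  rw [← integral_indicator (Set.toFinite _).measurableSet, integral_fintype .of_finite,
    ← (Equiv.arrowProdEquivProdArrow (Fin n) (fun _ => Fin n) fun _ => Bool).sum_comp,
    Finset.mul_sum]
  refine Finset.sum_congr rfl fun g _ => ?_
  rw [measureReal_parkMeasure_singleton, smul_eq_mul, mul_assoc]
  congr 2
  rw [Set.indicator_apply, parkEvent, Set.mem_ofPred_eq, allPark_iff, mul_ite, mul_one, mul_zero]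
  congr

/-- The weighted sum of `φ` of the last preference over the parking functions of length `m + 1`. -/
noncomputable def lastCarSum (p : ℝ) (m : ℕ) (φ : ℤ → ℝ) : ℝ :=
  ∑ k ∈ Finset.range (m + 1), m.choose k * (parkWeight p k * parkWeight p (m - k)) *
    ∑ a ∈ Finset.range (m + 1), (if a = k then 1 else if a < k then p else 1 - p) * φ a

lemma parkWeight_zero (p : ℝ) : parkWeight p 0 = 1 := by
  simp [parkWeight, parkSum, wordSum_zero]

lemma parkWeight_succ (p : ℝ) (m : ℕ) : parkWeight p (m + 1) = lastCarSum p m fun _ => 1 := by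
  rw [lastCarSum, ← sum_last_car p m fun _ => 1, parkWeight, parkSum, wordSum_succ]
  push_cast
  simp only [one_mul]

lemma sum_parking (p : ℝ) (m : ℕ) (φ : ℤ → ℝ) :
    ∑ g : Fin (m + 1) → Fin (m + 1) × Bool,
      (∏ i, (if (g i).2 = true then p else 1 - p)) * (φ (((g (Fin.last m)).1 : ℕ) : ℤ) *
        if spots (carWord (fun i => (g i).1) fun i => (g i).2) = Finset.Ico 0 ((m + 1 : ℕ) : ℤ)
          then 1 else 0) = lastCarSum p m φ := by
  let e : Fin (m + 1) × Bool ↪ ℤ × Bool :=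
    ⟨fun x => (((x.1 : ℕ) : ℤ), x.2), fun x y h => by
      simp only [Prod.mk.injEq, Nat.cast_inj] at h
      exact Prod.ext (Fin.ext h.1) h.2⟩
  have he : ∀ x, e x = (((x.1 : ℕ) : ℤ), x.2) := fun _ => rfl
  have hs : street 0 (m + 1) = Finset.univ.map e := by
    ext ⟨a, h⟩
    simp only [street, Finset.mem_product, Finset.mem_Ico, Finset.mem_univ, and_true,
      Finset.mem_map, Prod.exists, he, Prod.mk.injEq, true_and]
    constructor
    · rintro ⟨h0, hn⟩
      lift a to ℕ using h0
      exact ⟨⟨a, by omega⟩, h, rfl, rfl⟩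
    · rintro ⟨k, _, rfl, rfl⟩
      omega
  -- The head of the word is the last car. The default of `headD` plays no role, since the words
  -- have length `m + 1`.
  have h1 := sum_ofFn_reverse (fun x : Fin (m + 1) × Bool => if x.2 = true then p else 1 - p)
    (m + 1) fun w => φ ((w.map e).headD (0, true)).1 *
      if spots (w.map e) = Finset.Ico 0 ((m + 1 : ℕ) : ℤ) then 1 else 0
  rw [lastCarSum, ← sum_last_car]
  refine Eq.trans ?_ (h1.trans ?_)
  · refine Finset.sum_congr rfl fun g _ => ?_
    have hw : (List.ofFn g).reverse.map e = carWord (fun i => (g i).1) fun i => (g i).2 := by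
      rw [List.map_reverse, List.map_ofFn, carWord]
      rfl
    have hh : ((carWord (fun i => (g i).1) fun i => (g i).2).headD (0, true)).1 =
        (((g (Fin.last m)).1 : ℕ) : ℤ) := by
      rw [carWord, List.ofFn_succ', List.concat_eq_append, List.reverse_append]
      rfl
    rw [hw, hh]
  · rw [← wordSum_map (fun x : Fin (m + 1) × Bool => if x.2 = true then p else 1 - p)
      (coinWeight p) e (fun _ => rfl) _ _ fun w => φ (w.headD (0, true)).1 *
      if spots w = Finset.Ico 0 ((m + 1 : ℕ) : ℤ) then 1 else 0, ← hs, wordSum_succ]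
    refine Finset.sum_congr rfl fun x _ => ?_
    simp only [List.headD_cons, wordSum_const_mul]
    push_cast
    rfl

lemma condMeanLast_eq_div (m : ℕ) (p : unitInterval) :
    condMeanLast (m + 1) p =
      lastCarSum p m (fun a => (a : ℝ) + 1) / lastCarSum p m (fun _ => 1) := by
  have hE : (parkMeasure (m + 1) p).real (parkEvent (m + 1)) =
      (((m + 1 : ℕ) : ℝ) ^ (m + 1))⁻¹ * lastCarSum p m (fun _ => 1) := by
    have := setIntegral_parkMeasure (m + 1) p fun _ => 1
    rw [sum_parking p m fun _ => 1] at this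
    rw [← this]
    simp
  have hN : ∫ ω in parkEvent (m + 1), (lastPreference (m + 1) ω.1 : ℝ) ∂(parkMeasure (m + 1) p) =
      (((m + 1 : ℕ) : ℝ) ^ (m + 1))⁻¹ * lastCarSum p m (fun a => (a : ℝ) + 1) := by
    rw [setIntegral_parkMeasure, ← sum_parking]
    simp [lastPreference]
  have h0 : (((m + 1 : ℕ) : ℝ) ^ (m + 1))⁻¹ ≠ 0 := by positivity
  rw [condMeanLast, ProbabilityTheory.cond, integral_smul_measure, hN, smul_eq_mul,
    ENNReal.toReal_inv, ← measureReal_def, hE, ← div_eq_inv_mul, mul_div_mul_left _ _ h0]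

/-! ### Abel-type binomial identities -/

/-- Write y + (n - k) as (x + y + n) - (x + k), expand by the binomial theorem and exchange the
sums. The inner sum is then an iterated forward difference, which is explicit for suitable `g`. -/
lemma sum_choose_mul_pow_mul_pow (n : ℕ) (g : ℕ → ℝ) (x y : ℝ) :
    ∑ k ∈ Finset.range (n + 1), (n.choose k : ℝ) * (g k * (x + k) ^ k * (y + (n - k)) ^ (n - k)) =
      ∑ j ∈ Finset.range (n + 1), (n.choose j : ℝ) * (x + y + n) ^ j *
        ∑ k ∈ Finset.range (n - j + 1),
          (-1) ^ (n - j - k) * ((n - j).choose k : ℝ) * (g k * (x + k) ^ (n - j)) := by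
  have h1 : ∀ k ∈ Finset.range (n + 1),
      (n.choose k : ℝ) * (g k * (x + k) ^ k * (y + (n - k)) ^ (n - k)) =
      ∑ j ∈ Finset.range (n - k + 1), (n.choose j : ℝ) * (x + y + n) ^ j *
        ((-1) ^ (n - j - k) * ((n - j).choose k : ℝ) * (g k * (x + k) ^ (n - j))) := by
    intro k hk
    rw [show y + (n - k) = (x + y + n) + -(x + k) by ring,
      add_pow (x + y + n), Finset.mul_sum, Finset.mul_sum]
    refine Finset.sum_congr rfl fun j hj => ?_
    rw [Finset.mem_range] at hk hj
    have hc : n.choose k * (n - k).choose j = n.choose j * (n - j).choose k := by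
      rw [← Nat.choose_symm (show k ≤ n by omega), Nat.choose_mul (show j ≤ n - k by omega),
        ← Nat.choose_symm (show k ≤ n - j by omega)]
      congr 2
      omega
    have hc' : (n.choose k : ℝ) * (n - k).choose j = n.choose j * (n - j).choose k := by
      exact_mod_cast hc
    have hp : n - j = k + (n - k - j) := by omega
    rw [neg_pow, show n - j - k = n - k - j by omega,
      show (x + k : ℝ) ^ (n - j) = (x + k) ^ k * (x + k) ^ (n - k - j) by rw [hp, pow_add]]
    linear_combination (g k * (x + k) ^ k * (x + y + n) ^ j * (-1) ^ (n - k - j) *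
      (x + k) ^ (n - k - j)) * hc'
  rw [Finset.sum_congr rfl h1]
  simp only [Finset.mul_sum]
  refine Finset.sum_comm' fun k j => ?_
  simp only [Finset.mem_range]
  omega

lemma sum_neg_one_pow_mul_choose_mul_pow (m e : ℕ) (x : ℝ) :
    ∑ k ∈ Finset.range (m + 1), (-1) ^ (m - k) * (m.choose k : ℝ) * (x + k) ^ e =
      (fwdDiff 1)^[m] (fun r : ℝ => r ^ e) x := by
  rw [fwdDiff_iter_eq_sum_shift]
  refine Finset.sum_congr rfl fun k _ => ?_
  simp [zsmul_eq_mul]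

lemma sum_choose_mul_pow_mul_pow_eq_factorial (m : ℕ) :
    ∑ k ∈ Finset.range (m + 1), (m.choose k : ℝ) *
      ((1 + (k : ℝ)) ^ k * (1 + ((m : ℝ) - k)) ^ (m - k)) =
    ∑ j ∈ Finset.range (m + 1), (m.choose j : ℝ) * ((m : ℝ) + 2) ^ j * (m - j).factorial := by
  have h := sum_choose_mul_pow_mul_pow m (fun _ => 1) 1 1
  simp only [one_mul, sum_neg_one_pow_mul_choose_mul_pow, fwdDiff_iter_eq_factorial] at h
  rw [h]
  refine Finset.sum_congr rfl fun j _ => ?_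
  rw [show (1 : ℝ) + 1 + m = m + 2 by ring]
  rfl

/-- Abel's binomial identity. -/
lemma sum_choose_mul_div_mul_pow (m : ℕ) :
    ∑ k ∈ Finset.range (m + 1), (m.choose k : ℝ) *
      ((1 + (k : ℝ)) ^ k / (1 + k) * (1 + ((m : ℝ) - k)) ^ (m - k)) = ((m : ℝ) + 2) ^ m := by
  have h := sum_choose_mul_pow_mul_pow m (fun k => (1 + (k : ℝ))⁻¹) 1 1
  have hl : ∀ k : ℕ, (1 + (k : ℝ)) ^ k / (1 + k) = (1 + (k : ℝ))⁻¹ * (1 + (k : ℝ)) ^ k :=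
    fun k => by rw [div_eq_inv_mul]
  simp only [hl]
  -- For `j < m` the factor 1 / (1 + k) lowers the degree to m - j - 1, which the difference of
  -- order m - j annihilates. Only `j = m` survives.
  rw [h, Finset.sum_range_succ, Finset.sum_eq_zero, show (1 : ℝ) + 1 + m = m + 2 by ring]
  · simp
  · intro j hj
    rw [Finset.mem_range] at hj
    obtain ⟨e, he⟩ : ∃ e, m - j = e + 1 := ⟨m - j - 1, by omega⟩
    have hk : ∀ k : ℕ, (1 + (k : ℝ))⁻¹ * (1 + (k : ℝ)) ^ (e + 1) = (1 + (k : ℝ)) ^ e := fun k => by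
      rw [pow_succ]
      field_simp
    simp only [he, hk]
    rw [sum_neg_one_pow_mul_choose_mul_pow, fwdDiff_iter_pow_eq_zero_of_lt (Nat.lt_succ_self e)]
    simp

/-! ### Exact evaluation of the weights and of the mean -/

/-- The number of parking functions of length `n`, written so as to cover `n = 0`. -/
noncomputable def parkCount (n : ℕ) : ℝ := (1 + (n : ℝ)) ^ n / (1 + n)

lemma one_add_mul_parkCount (n : ℕ) : (1 + (n : ℝ)) * parkCount n = (1 + (n : ℝ)) ^ n := by
  rw [parkCount]
  field_simp

/-- The weight of the parking functions of length `m + 1` whose last car finds spot `k + 1` as the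
only free one. -/
noncomputable def gapWeight (m k : ℕ) : ℝ := m.choose k * (parkCount k * parkCount (m - k))

lemma sum_gapWeight_reflect (m : ℕ) (f : ℕ → ℝ) :
    ∑ k ∈ Finset.range (m + 1), gapWeight m k * f (m - k) =
      ∑ k ∈ Finset.range (m + 1), gapWeight m k * f k := by
  rw [← Finset.sum_range_reflect]
  refine Finset.sum_congr rfl fun k hk => ?_
  rw [Finset.mem_range] at hk
  rw [show m + 1 - 1 - k = m - k by omega, show m - (m - k) = k by omega, gapWeight, gapWeight,
    Nat.choose_symm (by omega), show m - (m - k) = k by omega]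
  ring

lemma sum_gapWeight_mul_right (m : ℕ) :
    ∑ k ∈ Finset.range (m + 1), gapWeight m k * (1 + (m - k : ℕ)) = ((m : ℝ) + 2) ^ m := by
  rw [← sum_choose_mul_div_mul_pow]
  refine Finset.sum_congr rfl fun k hk => ?_
  have := one_add_mul_parkCount (m - k)
  rw [Nat.cast_sub (by rw [Finset.mem_range] at hk; omega)] at *
  rw [gapWeight, ← this, ← parkCount]
  ring

lemma sum_gapWeight_mul_left (m : ℕ) :
    ∑ k ∈ Finset.range (m + 1), gapWeight m k * (1 + (k : ℝ)) = ((m : ℝ) + 2) ^ m := by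
  rw [← sum_gapWeight_mul_right]
  exact (sum_gapWeight_reflect m fun k => 1 + (k : ℝ)).symm

/-- The factors 1 + k and 1 + (m - k) add up to m + 2, and each of them has a known weighted sum. -/
lemma sum_gapWeight (m : ℕ) :
    ∑ k ∈ Finset.range (m + 1), gapWeight m k = 2 * ((m : ℝ) + 2) ^ m / (m + 2) := by
  rw [eq_div_iff (by positivity), two_mul]
  nth_rw 1 [← sum_gapWeight_mul_left]
  rw [← sum_gapWeight_mul_right, ← Finset.sum_add_distrib, Finset.sum_mul]
  refine Finset.sum_congr rfl fun k hk => ?_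
  rw [Nat.cast_sub (by rw [Finset.mem_range] at hk; omega)]
  ring

lemma sum_gapWeight_mul_mul (m : ℕ) :
    ∑ k ∈ Finset.range (m + 1), gapWeight m k * ((1 + (k : ℝ)) * (1 + (m - k : ℕ))) =
      ∑ j ∈ Finset.range (m + 1), (m.choose j : ℝ) * ((m : ℝ) + 2) ^ j * (m - j).factorial := by
  rw [← sum_choose_mul_pow_mul_pow_eq_factorial]
  refine Finset.sum_congr rfl fun k hk => ?_
  have h1 := one_add_mul_parkCount k
  have h2 := one_add_mul_parkCount (m - k)
  rw [Nat.cast_sub (by rw [Finset.mem_range] at hk; omega)] at *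
  rw [gapWeight, ← h1, ← h2]
  ring

lemma sum_coin_mul (p : ℝ) (φ : ℕ → ℝ) {k m : ℕ} (hk : k ≤ m) :
    ∑ a ∈ Finset.range (m + 1), (if a = k then 1 else if a < k then p else 1 - p) * φ a =
      φ k + p * ∑ a ∈ Finset.range k, φ a +
        (1 - p) * (∑ a ∈ Finset.range (m + 1), φ a - ∑ a ∈ Finset.range (k + 1), φ a) := by
  induction m, hk using Nat.le_induction with
  | base =>
    rw [Finset.sum_range_succ, if_pos rfl, Finset.mul_sum, sub_self, mul_zero, add_zero, one_mul,
      add_comm]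
    congr 1
    refine Finset.sum_congr rfl fun a ha => ?_
    have := Finset.mem_range.1 ha
    rw [if_neg (by omega), if_pos this]
  | succ m hm ih =>
    rw [Finset.sum_range_succ, ih, if_neg (by omega), if_neg (by omega),
      Finset.sum_range_succ φ (m + 1)]
    ring

lemma sum_coin (p : ℝ) {k m : ℕ} (hk : k ≤ m) :
    ∑ a ∈ Finset.range (m + 1), (if a = k then 1 else if a < k then p else 1 - p) * (1 : ℝ) =
      1 + p * k + (1 - p) * (m - k) := by
  rw [sum_coin_mul p (fun _ => 1) hk]
  simp

lemma sum_coin_mul_succ (p : ℝ) {k m : ℕ} (hk : k ≤ m) :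
    ∑ a ∈ Finset.range (m + 1),
      (if a = k then 1 else if a < k then p else 1 - p) * (((a : ℤ) : ℝ) + 1) =
      (k + 1) + p * (k * (k + 1) / 2) +
        (1 - p) * ((m + 1) * (m + 2) / 2 - (k + 1) * (k + 2) / 2) := by
  have hs : ∀ n : ℕ, ∑ a ∈ Finset.range n, (((a : ℤ) : ℝ) + 1) = n * (n + 1) / 2 := fun n => by
    induction n with
    | zero => simp
    | succ n ih =>
      rw [Finset.sum_range_succ, ih]
      push_cast
      ring
  rw [sum_coin_mul p (fun a => ((a : ℤ) : ℝ) + 1) hk, hs, hs, hs]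
  push_cast
  ring

/-- The coin factor is the mixture p (1 + k) + (1 - p) (1 + m - k). Both parts have the same
weighted sum, so `p` drops out. -/
lemma sum_gapWeight_mul_coin (p : ℝ) (m : ℕ) :
    ∑ k ∈ Finset.range (m + 1), gapWeight m k * (1 + p * k + (1 - p) * (m - k)) =
      ((m : ℝ) + 2) ^ m := by
  have h1 := sum_gapWeight_mul_left m
  have h2 := sum_gapWeight_mul_right m
  have h0 := sum_gapWeight m
  rw [eq_div_iff (by positivity)] at h0
  have : ∑ k ∈ Finset.range (m + 1), gapWeight m k * (1 + p * k + (1 - p) * (m - k)) =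
      p * ∑ k ∈ Finset.range (m + 1), gapWeight m k * (1 + (k : ℝ)) +
      (1 - p) * ∑ k ∈ Finset.range (m + 1), gapWeight m k * (1 + (m - k : ℕ)) := by
    rw [Finset.mul_sum, Finset.mul_sum, ← Finset.sum_add_distrib]
    refine Finset.sum_congr rfl fun k hk => ?_
    rw [Nat.cast_sub (by rw [Finset.mem_range] at hk; omega)]
    ring
  rw [this, h1, h2]
  ring

lemma parkWeight_eq (p : ℝ) (n : ℕ) : parkWeight p n = parkCount n := by
  induction n using Nat.strong_induction_on with
  | _ n ih =>
    cases n with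
    | zero => simp [parkWeight_zero, parkCount]
    | succ m =>
      rw [parkWeight_succ, lastCarSum]
      have : parkCount (m + 1) = ((m : ℝ) + 2) ^ m := by
        rw [parkCount, div_eq_iff (by positivity)]
        push_cast
        ring
      rw [this, ← sum_gapWeight_mul_coin p]
      refine Finset.sum_congr rfl fun k hk => ?_
      rw [Finset.mem_range] at hk
      rw [sum_coin p (by omega), ih k hk, ih (m - k) (by omega), gapWeight]

lemma lastCarSum_one (p : ℝ) (m : ℕ) : lastCarSum p m (fun _ => 1) = ((m : ℝ) + 2) ^ m := by
  rw [← sum_gapWeight_mul_coin p, lastCarSum]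
  refine Finset.sum_congr rfl fun k hk => ?_
  rw [Finset.mem_range] at hk
  rw [sum_coin p (by omega), parkWeight_eq, parkWeight_eq, gapWeight]

lemma lastCarSum_succ (p : ℝ) (m : ℕ) :
    lastCarSum p m (fun a => (a : ℝ) + 1) = ((m : ℝ) + 2) / 2 * ((m : ℝ) + 2) ^ m -
      (2 * p - 1) * ((∑ j ∈ Finset.range (m + 1),
        (m.choose j : ℝ) * ((m : ℝ) + 2) ^ j * (m - j).factorial) / 2 -
          ((m : ℝ) + 2) ^ m / 2) := by
  have h1 := sum_gapWeight_mul_left m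
  have h0 := sum_gapWeight m
  rw [eq_div_iff (by positivity)] at h0
  -- The last car's contribution is quadratic in k; it is expanded in 1, 1 + k and (1 + k)(1 + m -
  -- k), whose weighted sums are known.
  have : lastCarSum p m (fun a => (a : ℝ) + 1) =
      (1 - p) * (m + 1) / 2 * ((∑ k ∈ Finset.range (m + 1), gapWeight m k) * (m + 2)) +
      (1 - p / 2 - (1 - p) / 2 + (2 * p - 1) * (m + 2) / 2) *
        ∑ k ∈ Finset.range (m + 1), gapWeight m k * (1 + (k : ℝ)) -
      (2 * p - 1) / 2 *
        ∑ k ∈ Finset.range (m + 1), gapWeight m k * ((1 + (k : ℝ)) * (1 + (m - k : ℕ))) := by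
    rw [lastCarSum, Finset.sum_mul, Finset.mul_sum, Finset.mul_sum, Finset.mul_sum,
      ← Finset.sum_add_distrib, ← Finset.sum_sub_distrib]
    refine Finset.sum_congr rfl fun k hk => ?_
    rw [Finset.mem_range] at hk
    rw [sum_coin_mul_succ p (by omega), parkWeight_eq, parkWeight_eq, ← gapWeight,
      Nat.cast_sub (by omega)]
    ring
  rw [this, h0, h1, sum_gapWeight_mul_mul]
  ring

/-- An exact formula for the conditional mean of the last preference. -/
lemma condMeanLast_succ (m : ℕ) (p : unitInterval) :
    condMeanLast (m + 1) p = ((m : ℝ) + 2) / 2 - (2 * (p : ℝ) - 1) *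
      ((∑ j ∈ Finset.range (m + 1), (m.choose j : ℝ) * j.factorial / ((m : ℝ) + 2) ^ j) / 2
        - 1 / 2) := by
  have hpos : ((m : ℝ) + 2) ^ m ≠ 0 := by positivity
  have hsum : ∑ j ∈ Finset.range (m + 1), (m.choose j : ℝ) * ((m : ℝ) + 2) ^ j * (m - j).factorial =
      (∑ j ∈ Finset.range (m + 1), (m.choose j : ℝ) * j.factorial / ((m : ℝ) + 2) ^ j) *
        ((m : ℝ) + 2) ^ m := by
    rw [← Finset.sum_range_reflect, Finset.sum_mul]
    refine Finset.sum_congr rfl fun j hj => ?_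
    rw [Finset.mem_range] at hj
    rw [show m + 1 - 1 - j = m - j by omega, Nat.choose_symm (by omega),
      show m - (m - j) = j by omega, show ((m : ℝ) + 2) ^ m = (m + 2) ^ (m - j) * (m + 2) ^ j by
        rw [← pow_add]; congr 1; omega]
    field_simp
  rw [condMeanLast_eq_div, lastCarSum_one, lastCarSum_succ, hsum]
  field_simp

/-! ### Bounds for the logarithm -/

lemma nonneg_of_hasDerivAt {f f' : ℝ → ℝ} (h0 : f 0 = 0)
    (hd : ∀ u, 0 ≤ u → HasDerivAt f (f' u) u) (hf : ∀ u, 0 ≤ u → 0 ≤ f' u) {u : ℝ} (hu : 0 ≤ u) :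
    0 ≤ f u := by
  have hm : MonotoneOn f (Set.Ici 0) := by
    refine monotoneOn_of_hasDerivWithinAt_nonneg (f' := f') (convex_Ici 0)
      (fun x hx => (hd x hx).continuousAt.continuousWithinAt) (fun x hx => ?_) fun x hx => ?_
    · exact (hd x (interior_subset hx)).hasDerivWithinAt
    · exact hf x (interior_subset hx)
  rw [← h0]
  exact hm Set.self_mem_Ici hu hu

lemma hasDerivAt_log_one_add {u : ℝ} (hu : 0 ≤ u) :
    HasDerivAt (fun u : ℝ => Real.log (1 + u)) (1 / (1 + u)) u :=
  ((hasDerivAt_id u).const_add 1).log (by simp only [id]; positivity)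

lemma sub_sq_le_log_one_add {u : ℝ} (hu : 0 ≤ u) : u - u ^ 2 / 2 ≤ Real.log (1 + u) := by
  rw [← sub_nonneg]
  refine nonneg_of_hasDerivAt (f := fun u => Real.log (1 + u) - (u - u ^ 2 / 2))
    (f' := fun u => u ^ 2 / (1 + u)) (by simp) (fun u hu => ?_) (fun u hu => by positivity) hu
  have := (hasDerivAt_log_one_add hu).sub ((hasDerivAt_id u).sub ((hasDerivAt_pow 2 u).div_const 2))
  refine this.congr_deriv ?_
  push_cast
  field_simp
  ring

lemma log_one_add_le_cubic {u : ℝ} (hu : 0 ≤ u) :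
    Real.log (1 + u) ≤ u - u ^ 2 / 2 + u ^ 3 / 3 := by
  rw [← sub_nonneg]
  refine nonneg_of_hasDerivAt (f := fun u => u - u ^ 2 / 2 + u ^ 3 / 3 - Real.log (1 + u))
    (f' := fun u => u ^ 3 / (1 + u)) (by simp) (fun u hu => ?_) (fun u hu => by positivity) hu
  have := (((hasDerivAt_id u).sub ((hasDerivAt_pow 2 u).div_const 2)).add
    ((hasDerivAt_pow 3 u).div_const 3)).sub
    (hasDerivAt_log_one_add hu)
  refine this.congr_deriv ?_
  push_cast
  field_simp
  ring

lemma quartic_le_log_one_add {u : ℝ} (hu : 0 ≤ u) :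
    u - u ^ 2 / 2 + u ^ 3 / 3 - u ^ 4 / 4 ≤ Real.log (1 + u) := by
  rw [← sub_nonneg]
  refine nonneg_of_hasDerivAt
    (f := fun u => Real.log (1 + u) - (u - u ^ 2 / 2 + u ^ 3 / 3 - u ^ 4 / 4))
    (f' := fun u => u ^ 4 / (1 + u)) (by simp) (fun u hu => ?_) (fun u hu => by positivity) hu
  have := (hasDerivAt_log_one_add hu).sub
    ((((hasDerivAt_id u).sub ((hasDerivAt_pow 2 u).div_const 2)).add
    ((hasDerivAt_pow 3 u).div_const 3)).sub ((hasDerivAt_pow 4 u).div_const 4))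
  refine this.congr_deriv ?_
  push_cast
  field_simp
  ring

lemma log_one_add_le_sub_div {u : ℝ} (hu : 0 ≤ u) :
    Real.log (1 + u) ≤ u - u ^ 2 / (2 * (1 + u)) := by
  rw [← sub_nonneg]
  refine nonneg_of_hasDerivAt (f := fun u => u - u ^ 2 / (2 * (1 + u)) - Real.log (1 + u))
    (f' := fun u => u ^ 2 / (2 * (1 + u) ^ 2)) (by simp) (fun u hu => ?_)
    (fun u hu => by positivity) hu
  have h2 : HasDerivAt (fun u : ℝ => 2 * (1 + u)) 2 u := by
    simpa using ((hasDerivAt_id u).const_add 1).const_mul 2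
  have := ((hasDerivAt_id u).sub ((hasDerivAt_pow 2 u).div h2 (by positivity))).sub
    (hasDerivAt_log_one_add hu)
  refine this.congr_deriv ?_
  push_cast
  field_simp
  ring

/-! ### The rescaled integrand and its first-order expansion -/

/-- The rescaled exponent `N (log (1 + t / √N) - t / √N)`, in terms of `s = 1 / √N`. -/
noncomputable def expo (s t : ℝ) : ℝ := (Real.log (1 + s * t) - s * t) / s ^ 2

lemma expo_lower {s t : ℝ} (hs : 0 < s) (ht : 0 ≤ t) : -(t ^ 2 / 2) ≤ expo s t := by
  rw [expo, le_div_iff₀ (by positivity)]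
  have := sub_sq_le_log_one_add (u := s * t) (by positivity)
  nlinarith

lemma expo_upper {s t : ℝ} (hs : 0 < s) (ht : 0 ≤ t) :
    expo s t ≤ -(t ^ 2 / 2) + s * (t ^ 3 / 3) := by
  rw [expo, div_le_iff₀ (by positivity)]
  have := log_one_add_le_cubic (u := s * t) (by positivity)
  nlinarith

lemma expo_lower_cubic {s t : ℝ} (hs : 0 < s) (ht : 0 ≤ t) :
    -(t ^ 2 / 2) + s * (t ^ 3 / 3 - s * t ^ 4 / 4) ≤ expo s t := by
  rw [expo, le_div_iff₀ (by positivity)]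
  have := quartic_le_log_one_add (u := s * t) (by positivity)
  nlinarith

/-- The cubic upper bound is useless for large `t`. This one is uniform in `s ≤ 1` and supplies an
integrable majorant; it rests on t² ≥ (t - 1)(t + 1). -/
lemma expo_le_linear {s t : ℝ} (hs : 0 < s) (hs1 : s ≤ 1) (ht : 0 ≤ t) :
    expo s t ≤ 1 / 2 - t / 2 := by
  have h1 : expo s t ≤ -(t ^ 2 / (2 * (1 + s * t))) := by
    rw [expo, div_le_iff₀ (by positivity)]
    have := log_one_add_le_sub_div (u := s * t) (by positivity)
    have e : (s * t) ^ 2 / (2 * (1 + s * t)) = t ^ 2 / (2 * (1 + s * t)) * s ^ 2 := by ring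
    rw [e] at this
    linarith
  refine h1.trans ?_
  have h2 : t / 2 - 1 / 2 ≤ t ^ 2 / (2 * (1 + s * t)) := by
    rw [le_div_iff₀ (by positivity)]
    have : s * t ≤ t := by nlinarith
    rcases le_total t 1 with h | h
    · nlinarith [mul_nonneg hs.le ht]
    · nlinarith [mul_nonneg hs.le ht]
  linarith

/-- The rescaled integrand. -/
noncomputable def kern (s t : ℝ) : ℝ := Real.exp (expo s t) / (1 + s * t) ^ 2

/-- The term t³ / 3 bounds the error in the exponent, and 2t the error from the factor 1 / (1 +
st)². -/
lemma abs_kern_sub_le {s t : ℝ} (hs : 0 < s) (hs1 : s ≤ 1) (ht : 0 ≤ t) :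
    |(kern s t - Real.exp (-(t ^ 2 / 2))) / s| ≤
      (t ^ 3 / 3 + 2 * t) * Real.exp (1 / 2 - t / 2) := by
  have hE : Real.exp (expo s t) ≤ Real.exp (1 / 2 - t / 2) :=
    Real.exp_le_exp.2 (expo_le_linear hs hs1 ht)
  have hE0 := Real.exp_pos (expo s t)
  rw [abs_div, abs_of_pos hs, div_le_iff₀ hs]
  have hst : 0 ≤ s * t := by positivity
  have h1 : Real.exp (-(t ^ 2 / 2)) ≤ Real.exp (expo s t) := Real.exp_le_exp.2 (expo_lower hs ht)
  have h2 : Real.exp (expo s t) - Real.exp (-(t ^ 2 / 2)) ≤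
      s * (t ^ 3 / 3) * Real.exp (1 / 2 - t / 2) := by
    have h3 : 1 - Real.exp (-(t ^ 2 / 2) - expo s t) ≤ s * (t ^ 3 / 3) := by
      have := Real.add_one_le_exp (-(t ^ 2 / 2) - expo s t)
      have := expo_upper hs ht
      linarith
    have h4 : Real.exp (expo s t) - Real.exp (-(t ^ 2 / 2)) =
        (1 - Real.exp (-(t ^ 2 / 2) - expo s t)) * Real.exp (expo s t) := by
      rw [sub_mul, ← Real.exp_add, one_mul]
      congr 2
      ring
    rw [h4]
    exact (mul_le_mul_of_nonneg_right h3 hE0.le).trans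
      (mul_le_mul_of_nonneg_left hE (by positivity))
  have h5 : kern s t ≤ Real.exp (expo s t) := div_le_self hE0.le (by nlinarith)
  have h6 : Real.exp (expo s t) - kern s t ≤ s * (2 * t) * Real.exp (1 / 2 - t / 2) := by
    have h7 : 1 - 1 / (1 + s * t) ^ 2 ≤ s * (2 * t) := by
      rw [sub_le_iff_le_add, ← sub_le_iff_le_add', le_div_iff₀ (by positivity)]
      nlinarith [mul_nonneg hst hst, mul_nonneg (mul_nonneg hst hst) hst]
    have h8 : Real.exp (expo s t) - kern s t =
        (1 - 1 / (1 + s * t) ^ 2) * Real.exp (expo s t) := by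
      rw [kern]
      ring
    rw [h8]
    exact (mul_le_mul_of_nonneg_right h7 hE0.le).trans
      (mul_le_mul_of_nonneg_left hE (by positivity))
  rw [abs_le]
  constructor <;> nlinarith

lemma tendsto_kern (t : ℝ) (ht : 0 ≤ t) :
    Tendsto (fun s : ℝ => (kern s t - Real.exp (-(t ^ 2 / 2))) / s) (nhdsWithin 0 (Set.Ioi 0))
      (nhds ((t ^ 3 / 3 - 2 * t) * Real.exp (-(t ^ 2 / 2)))) := by
  have hid : Tendsto (fun s : ℝ => s) (nhdsWithin 0 (Set.Ioi 0)) (nhds 0) :=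
    tendsto_id.mono_left nhdsWithin_le_nhds
  have hpos : ∀ᶠ s : ℝ in nhdsWithin 0 (Set.Ioi 0), 0 < s := self_mem_nhdsWithin
  have hq : Tendsto (fun s => (Real.exp (expo s t + t ^ 2 / 2) - 1) / s)
      (nhdsWithin 0 (Set.Ioi 0)) (nhds (t ^ 3 / 3)) := by
    refine tendsto_of_tendsto_of_tendsto_of_le_of_le'
      (g := fun s => t ^ 3 / 3 - s * t ^ 4 / 4)
      (h := fun s => t ^ 3 / 3 * Real.exp (s * (t ^ 3 / 3))) ?_ ?_ ?_ ?_
    · have : Tendsto (fun s : ℝ => t ^ 3 / 3 - s * t ^ 4 / 4) (nhds 0)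
          (nhds (t ^ 3 / 3 - 0 * t ^ 4 / 4)) := Continuous.tendsto (by fun_prop) 0
      simpa using this.mono_left nhdsWithin_le_nhds
    · have : Tendsto (fun s : ℝ => t ^ 3 / 3 * Real.exp (s * (t ^ 3 / 3))) (nhds 0)
          (nhds (t ^ 3 / 3 * Real.exp (0 * (t ^ 3 / 3)))) := Continuous.tendsto (by fun_prop) 0
      simpa using this.mono_left nhdsWithin_le_nhds
    · filter_upwards [hpos] with s hs
      rw [le_div_iff₀ hs]
      have := expo_lower_cubic hs ht
      have := Real.add_one_le_exp (expo s t + t ^ 2 / 2)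
      linarith
    · filter_upwards [hpos] with s hs
      rw [div_le_iff₀ hs]
      have h1 := expo_upper hs ht
      have h2 : Real.exp (expo s t + t ^ 2 / 2) ≤ Real.exp (s * (t ^ 3 / 3)) :=
        Real.exp_le_exp.2 (by linarith)
      -- From 1 - x ≤ exp(-x) follows exp(x) - 1 ≤ x exp(x), here with x = s t³ / 3.
      have h3 := Real.add_one_le_exp (-(s * (t ^ 3 / 3)))
      have h4 : Real.exp (-(s * (t ^ 3 / 3))) * Real.exp (s * (t ^ 3 / 3)) = 1 := by
        rw [← Real.exp_add]
        simp
      nlinarith [Real.exp_pos (s * (t ^ 3 / 3))]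
  have hr : Tendsto (fun s : ℝ => 1 / (1 + s * t) ^ 2) (nhdsWithin 0 (Set.Ioi 0)) (nhds 1) := by
    have : ContinuousAt (fun s : ℝ => 1 / (1 + s * t) ^ 2) 0 :=
      ContinuousAt.div (by fun_prop) (by fun_prop) (by simp)
    have h := this.tendsto
    norm_num at h
    simpa using h.mono_left nhdsWithin_le_nhds
  have hr' : Tendsto (fun s : ℝ => (2 * t + s * t ^ 2) / (1 + s * t) ^ 2)
      (nhdsWithin 0 (Set.Ioi 0)) (nhds (2 * t)) := by
    have : ContinuousAt (fun s : ℝ => (2 * t + s * t ^ 2) / (1 + s * t) ^ 2) 0 :=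
      ContinuousAt.div (by fun_prop) (by fun_prop) (by simp)
    have h := this.tendsto
    norm_num at h
    exact h.mono_left nhdsWithin_le_nhds
  -- Uses 1 / (1 + st)² - 1 = -s (2t + st²) / (1 + st)².
  have := ((hq.mul hr).sub hr').mul_const (Real.exp (-(t ^ 2 / 2)))
  rw [mul_one] at this
  refine this.congr' ?_
  filter_upwards [hpos] with s hs
  have hst : 1 + s * t ≠ 0 := by positivity
  rw [kern, Real.exp_add, show Real.exp (-(t ^ 2 / 2)) = (Real.exp (t ^ 2 / 2))⁻¹ from
    Real.exp_neg _]
  field_simp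
  ring

/-! ### Gamma and Gaussian integrals, dominated convergence -/

lemma integrableOn_pow_mul_exp (k : ℕ) {b : ℝ} (hb : 0 < b) :
    IntegrableOn (fun t : ℝ => t ^ k * Real.exp (-b * t)) (Set.Ioi 0) := by
  have := integrableOn_rpow_mul_exp_neg_mul_rpow (p := 1) (s := k) (b := b)
    (by have : (0 : ℝ) ≤ k := k.cast_nonneg; linarith) one_pos hb
  simpa using this

lemma integral_pow_mul_exp (k : ℕ) :
    ∫ t in Set.Ioi (0 : ℝ), t ^ k * Real.exp (-t) = k.factorial := by
  rw [← Real.Gamma_nat_eq_factorial, Real.Gamma_eq_integral (by positivity)]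
  refine setIntegral_congr_fun measurableSet_Ioi fun t _ => ?_
  simp [mul_comm]

lemma integral_gaussian_half : ∫ t in Set.Ioi (0 : ℝ), Real.exp (-(t ^ 2 / 2)) =
    Real.sqrt (2 * Real.pi) / 2 := by
  have := integral_gaussian_Ioi (1 / 2)
  rw [show Real.pi / (1 / 2) = 2 * Real.pi by ring] at this
  rw [← this]
  refine setIntegral_congr_fun measurableSet_Ioi fun t _ => ?_
  ring_nf

lemma integrableOn_pow_mul_gaussian (k : ℕ) :
    IntegrableOn (fun t : ℝ => t ^ k * Real.exp (-(t ^ 2 / 2))) (Set.Ioi 0) := by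
  have := integrableOn_rpow_mul_exp_neg_mul_sq (b := 1 / 2) (by norm_num) (s := k)
    (by have : (0 : ℝ) ≤ k := k.cast_nonneg; linarith)
  refine this.congr_fun (fun t _ => ?_) measurableSet_Ioi
  simp only [Real.rpow_natCast]
  congr 2
  ring

lemma integral_mul_gaussian :
    ∫ t in Set.Ioi (0 : ℝ), t * Real.exp (-(t ^ 2 / 2)) = 1 := by
  have := integral_rpow_mul_exp_neg_mul_rpow (p := 2) (q := 1) (b := 1 / 2)
    (by norm_num) (by norm_num) (by norm_num)
  norm_num [Real.Gamma_one, Real.rpow_neg_one] at this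
  rw [← this]
  refine setIntegral_congr_fun measurableSet_Ioi fun t _ => ?_
  ring_nf

lemma integral_cube_mul_gaussian :
    ∫ t in Set.Ioi (0 : ℝ), t ^ 3 * Real.exp (-(t ^ 2 / 2)) = 2 := by
  have := integral_rpow_mul_exp_neg_mul_rpow (p := 2) (q := 3) (b := 1 / 2)
    (by norm_num) (by norm_num) (by norm_num)
  norm_num [Real.Gamma_two] at this
  refine Eq.trans ?_ this
  refine setIntegral_congr_fun measurableSet_Ioi fun t _ => ?_
  ring_nf

lemma integral_cubic_mul_gaussian :
    ∫ t in Set.Ioi (0 : ℝ), (t ^ 3 / 3 - 2 * t) * Real.exp (-(t ^ 2 / 2)) = -(4 / 3) := by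
  have h3 := (integrableOn_pow_mul_gaussian 3).const_mul (1 / 3)
  have h1 := (integrableOn_pow_mul_gaussian 1).const_mul 2
  have := integral_sub h3 h1
  simp only [integral_const_mul, integral_cube_mul_gaussian, pow_one, integral_mul_gaussian] at this
  rw [show (-(4 / 3) : ℝ) = 1 / 3 * 2 - 2 * 1 by norm_num, ← this]
  refine setIntegral_congr_fun measurableSet_Ioi fun t _ => ?_
  ring

lemma continuousOn_kern {s : ℝ} (hs : 0 < s) : ContinuousOn (kern s) (Set.Ioi 0) := by
  have h : ∀ t ∈ Set.Ioi (0 : ℝ), 1 + s * t ≠ 0 := fun t ht => by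
    rw [Set.mem_Ioi] at ht
    positivity
  unfold kern expo
  refine ContinuousOn.div (ContinuousOn.rexp (ContinuousOn.div_const (ContinuousOn.sub
    (ContinuousOn.log (by fun_prop) h) (by fun_prop)) _)) (by fun_prop) fun t ht => ?_
  exact pow_ne_zero _ (h t ht)

lemma integrableOn_bound : IntegrableOn
    (fun t : ℝ => (t ^ 3 / 3 + 2 * t) * Real.exp (1 / 2 - t / 2)) (Set.Ioi 0) := by
  have h3 := (integrableOn_pow_mul_exp 3 (b := 1 / 2) (by norm_num)).const_mul
    (1 / 3 * Real.exp (1 / 2))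
  have h1 := (integrableOn_pow_mul_exp 1 (b := 1 / 2) (by norm_num)).const_mul
    (2 * Real.exp (1 / 2))
  refine (IntegrableOn.add h3 h1).congr_fun (fun t _ => ?_) measurableSet_Ioi
  simp only [Pi.add_apply]
  rw [show 1 / 2 - t / 2 = 1 / 2 + -(1 / 2) * t by ring, Real.exp_add]
  ring

lemma tendsto_integral_kern {s : ℕ → ℝ} (hs : ∀ m, 0 < s m) (hs1 : ∀ m, s m ≤ 1)
    (hs0 : Tendsto s atTop (nhds 0)) :
    Tendsto (fun m => ∫ t in Set.Ioi (0 : ℝ), (kern (s m) t - Real.exp (-(t ^ 2 / 2))) / s m)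
      atTop (nhds (-(4 / 3))) := by
  rw [← integral_cubic_mul_gaussian]
  refine tendsto_integral_of_dominated_convergence
    (fun t => (t ^ 3 / 3 + 2 * t) * Real.exp (1 / 2 - t / 2)) (fun m => ?_) integrableOn_bound
    (fun m => ?_) ?_
  · refine ContinuousOn.aestronglyMeasurable ?_ measurableSet_Ioi
    exact ((continuousOn_kern (hs m)).sub (by fun_prop)).div_const _
  · filter_upwards [ae_restrict_mem measurableSet_Ioi] with t ht
    exact abs_kern_sub_le (hs m) (hs1 m) (le_of_lt ht)
  · filter_upwards [ae_restrict_mem measurableSet_Ioi] with t ht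
    refine (tendsto_kern t (le_of_lt ht)).comp ?_
    exact tendsto_nhdsWithin_iff.2 ⟨hs0, Eventually.of_forall hs⟩

/-! ### Asymptotics of the sum -/

/-- Replace j! by the integral of x ^ j exp(-x) and sum the binomial series. -/
lemma sum_choose_mul_factorial_div (m : ℕ) (N : ℝ) :
    ∑ j ∈ Finset.range (m + 1), (m.choose j : ℝ) * j.factorial / N ^ j =
      ∫ x in Set.Ioi (0 : ℝ), Real.exp (-x) * (1 + x / N) ^ m := by
  have h : ∀ x : ℝ, Real.exp (-x) * (1 + x / N) ^ m =
      ∑ j ∈ Finset.range (m + 1), (m.choose j : ℝ) / N ^ j * (x ^ j * Real.exp (-x)) := by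
    intro x
    rw [add_comm 1, add_pow, Finset.mul_sum]
    refine Finset.sum_congr rfl fun j _ => ?_
    rw [div_pow, one_pow]
    ring
  simp only [h]
  rw [integral_finsetSum]
  · refine Finset.sum_congr rfl fun j _ => ?_
    rw [integral_const_mul, integral_pow_mul_exp]
    ring
  · intro j _
    have := (integrableOn_pow_mul_exp j one_pos).const_mul ((m.choose j : ℝ) / N ^ j)
    simpa using this

/-- The exponential produces (1 + st) ^ (m + 2), and the square in the denominator of `kern` brings
the power down to `m`. -/
lemma kern_eq {m : ℕ} {s t : ℝ} (hs : 0 < s) (hsm : (s ^ 2)⁻¹ = (m : ℝ) + 2) (ht : 0 ≤ t) :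
    kern s t = Real.exp (-(s⁻¹ * t)) * (1 + s⁻¹ * t / (m + 2)) ^ m := by
  have hpos : 0 < 1 + s * t := by positivity
  have h1 : expo s t = -(s⁻¹ * t) + ((m + 2 : ℕ) : ℝ) * Real.log (1 + s * t) := by
    rw [expo, div_eq_mul_inv, hsm]
    push_cast
    rw [← hsm]
    field_simp
    ring
  have h2 : s⁻¹ * t / (m + 2) = s * t := by
    rw [← hsm]
    field_simp
  rw [kern, h1, h2, Real.exp_add, Real.exp_nat_mul, Real.exp_log hpos, pow_add]
  field_simp

lemma integral_kern_eq {s : ℝ} (hs : 0 < s) (hs1 : s ≤ 1) :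
    s⁻¹ * ∫ t in Set.Ioi (0 : ℝ), kern s t =
      (∫ t in Set.Ioi (0 : ℝ), (kern s t - Real.exp (-(t ^ 2 / 2))) / s) +
        s⁻¹ * (Real.sqrt (2 * Real.pi) / 2) := by
  have hF : IntegrableOn (fun t => (kern s t - Real.exp (-(t ^ 2 / 2))) / s) (Set.Ioi 0) := by
    refine Integrable.mono' integrableOn_bound ?_ ?_
    · refine ContinuousOn.aestronglyMeasurable ?_ measurableSet_Ioi
      exact ((continuousOn_kern hs).sub (by fun_prop)).div_const _
    · filter_upwards [ae_restrict_mem measurableSet_Ioi] with t ht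
      exact abs_kern_sub_le hs hs1 (le_of_lt ht)
  have hG : IntegrableOn (fun t : ℝ => s⁻¹ * Real.exp (-(t ^ 2 / 2))) (Set.Ioi 0) := by
    have := (integrableOn_pow_mul_gaussian 0).const_mul s⁻¹
    simpa [IntegrableOn] using this
  rw [← integral_gaussian_half, ← integral_const_mul, ← integral_const_mul, ← integral_add hF hG]
  refine setIntegral_congr_fun measurableSet_Ioi fun t _ => ?_
  ring

lemma sum_choose_eq_integral_kern (m : ℕ) :
    ∑ j ∈ Finset.range (m + 1), (m.choose j : ℝ) * j.factorial / ((m : ℝ) + 2) ^ j =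
      (∫ t in Set.Ioi (0 : ℝ), (kern (Real.sqrt (m + 2))⁻¹ t - Real.exp (-(t ^ 2 / 2))) /
        (Real.sqrt (m + 2))⁻¹) + Real.sqrt (m + 2) * (Real.sqrt (2 * Real.pi) / 2) := by
  have hr : 0 < Real.sqrt (m + 2) := Real.sqrt_pos.2 (by positivity)
  have hs : 0 < (Real.sqrt (m + 2))⁻¹ := inv_pos.2 hr
  have hs1 : (Real.sqrt (m + 2))⁻¹ ≤ 1 := inv_le_one_of_one_le₀ (by
    rw [Real.one_le_sqrt]
    linarith [(m.cast_nonneg : (0 : ℝ) ≤ m)])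
  have hsm : ((Real.sqrt (m + 2))⁻¹ ^ 2)⁻¹ = (m : ℝ) + 2 := by
    rw [inv_pow, inv_inv, Real.sq_sqrt (by positivity)]
  have h := integral_kern_eq hs hs1
  -- Substitution x = t / s; the Jacobian cancels the prefactor 1 / s.
  rw [setIntegral_congr_fun measurableSet_Ioi fun t ht => kern_eq hs hsm (le_of_lt ht),
    integral_comp_mul_left_Ioi (fun x => Real.exp (-x) * (1 + x / ((m : ℝ) + 2)) ^ m) 0
      (inv_pos.2 hs), mul_zero, ← sum_choose_mul_factorial_div, smul_eq_mul, ← mul_assoc,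
    mul_inv_cancel₀ (inv_pos.2 hs).ne', one_mul] at h
  rw [h, inv_inv]

/-- The integral produces √(n + 1), while the theorem has √n. -/
lemma tendsto_sqrt_sub_sqrt :
    Tendsto (fun m : ℕ => Real.sqrt ((m : ℝ) + 1) - Real.sqrt (m + 2)) atTop (nhds 0) := by
  have hinv : Tendsto (fun m : ℕ => -(Real.sqrt ((m : ℝ) + 1))⁻¹) atTop (nhds 0) := by
    rw [← neg_zero]
    refine Tendsto.neg (tendsto_inv_atTop_zero.comp (Real.tendsto_sqrt_atTop.comp ?_))
    exact tendsto_atTop_add_const_right _ _ tendsto_natCast_atTop_atTop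
  refine tendsto_of_tendsto_of_tendsto_of_le_of_le hinv tendsto_const_nhds (fun m => ?_) fun m => ?_
  · have h1 : 0 < Real.sqrt ((m : ℝ) + 1) := Real.sqrt_pos.2 (by positivity)
    have h2 : Real.sqrt ((m : ℝ) + 2) ≤ Real.sqrt (m + 1) + (Real.sqrt ((m : ℝ) + 1))⁻¹ := by
      refine Real.sqrt_le_iff.2 ⟨by positivity, ?_⟩
      have e1 := Real.sq_sqrt (show (0 : ℝ) ≤ (m : ℝ) + 1 by positivity)
      have e2 := mul_inv_cancel₀ h1.ne'
      nlinarith [sq_nonneg (Real.sqrt ((m : ℝ) + 1))⁻¹]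
    dsimp only
    linarith
  · have := Real.sqrt_le_sqrt (show (m : ℝ) + 1 ≤ m + 2 by linarith)
    dsimp only
    linarith

lemma tendsto_sum_choose_sub :
    Tendsto (fun m : ℕ =>
      (∑ j ∈ Finset.range (m + 1), (m.choose j : ℝ) * j.factorial / ((m : ℝ) + 2) ^ j) -
        Real.sqrt (2 * Real.pi) / 2 * Real.sqrt (m + 1)) atTop (nhds (-(4 / 3))) := by
  have hinf : Tendsto (fun m : ℕ => Real.sqrt ((m : ℝ) + 2)) atTop atTop :=
    Real.tendsto_sqrt_atTop.comp
      (tendsto_atTop_add_const_right _ _ tendsto_natCast_atTop_atTop)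
  have h := tendsto_integral_kern (s := fun m : ℕ => (Real.sqrt ((m : ℝ) + 2))⁻¹)
    (fun m => inv_pos.2 (Real.sqrt_pos.2 (by positivity)))
    (fun m => inv_le_one_of_one_le₀ (by
      rw [Real.one_le_sqrt]
      linarith [(m.cast_nonneg : (0 : ℝ) ≤ m)]))
    (tendsto_inv_atTop_zero.comp hinf)
  have h' := h.sub (tendsto_sqrt_sub_sqrt.const_mul (Real.sqrt (2 * Real.pi) / 2))
  rw [mul_zero, sub_zero] at h'
  refine h'.congr fun m => ?_
  rw [sum_choose_eq_integral_kern]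
  ring

end ParkingCoin

theorem theorem4 (p : unitInterval) :
    (fun n : ℕ =>
        ParkingCoin.condMeanLast n p -
          (((n : ℝ) + 1) / 2 -
            (2 * (p : ℝ) - 1) * (Real.sqrt (2 * Real.pi) / 4 * (n : ℝ) ^ (1 / 2 : ℝ) - 7 / 6)))
      =o[atTop] (fun _ : ℕ => (1 : ℝ)) := by
  -- The exact formula is for n = m + 1; the value at n = 0 does not affect the limit.
  rw [isLittleO_one_iff, ← tendsto_add_atTop_iff_nat 1]
  have h := (ParkingCoin.tendsto_sum_choose_sub.add_const (4 / 3)).const_mul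
    (-(2 * (p : ℝ) - 1) / 2)
  rw [neg_add_cancel, mul_zero] at h
  refine h.congr fun m => ?_
  rw [ParkingCoin.condMeanLast_succ, ← Real.sqrt_eq_rpow]
  push_cast
  ring
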